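/- Let $d\ge 2$. For $t>0$ let $p_t(x)=\kappa_d\,t\,(t^2+|x|^2)^{-(d+1)/2}$, $x\in\mathbb R^d$, be the Poisson kernel, where $\kappa_d=\Gamma(\frac{d+1}{2})\pi^{-(d+1)/2}$, and let $A_d=2\pi^{d/2}/\Gamma(d/2)$ be the surface area of the unit sphere $\mathbb S^{d-1}$. For a bounded Lebesgue measurable set $\Omega\subset\mathbb R^d$ with $|\Omega|>0$ put $$\mathbb H_\Omega(t)=\int_\Omega\int_\Omega p_t(x-y)\,dy\,dx,\qquad \mathrm{Per}(\Omega)=\sup\Big\{\int_\Omega \operatorname{div}\varphi\,dx:\varphi\in C^1_c(\mathbb R^d,\mathbb R^d),\ \|\varphi\|_\infty\le 1\Big\},$$ $$g_\Omega(y)=|\Omega\cap(\Omega+y)|,\qquad \ell_\Omega=\inf\{\ell>0: g_\Omega(y)=0\text{ for all }|y|\ge \ell\},$$ and, for $u\in\mathbb S^{d-1}$ and $s>0$, $$V_u(\Omega)=\sup\Big\{\int_\Omega\langle\nabla\varphi(x),u\rangle\,dx:\varphi\in C^1_c(\mathbb R^d,\mathbb R),\ \|\varphi\|_\infty\le1\Big\},$$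 $$\gamma_\Omega(s)=\int_{\mathbb S^{d-1}}\Big(\frac{V_u(\Omega)}2-\frac{g_\Omega(0)-g_\Omega(su)}{s}\Big)\,d\sigma(u),$$ where $\sigma$ is the surface measure on $\mathbb S^{d-1}$. Let $\mathcal W$ be the class of bounded Lebesgue measurable sets $\Omega\subset\mathbb R^d$ with $|\Omega|>0$ and $\mathrm{Per}(\Omega)<\infty$ for which $s\mapsto s^{-1}\gamma_\Omega(\ell_\Omega s)$ is integrable on $(0,1)$. Then for every $\Omega\in\mathcal W$ the limit below exists and $$\lim_{t\to0+}\frac1t\Big(|\Omega|-\mathbb H_\Omega(t)-\frac{\mathrm{Per}(\Omega)}{\pi}\,t\ln\frac1t\Big)=\kappa_d\Big(\frac{|\Omega|A_d}{\ell_\Omega}-\int_0^1 s^{-1}\gamma_\Omega(\ell_\Omega s)\,ds\Big)+\frac{\mathrm{Per}(\Omega)}{\pi}\Big(\ln(2\ell_\Omega)+\int_0^\infty(\tanh^d\theta-1)\,d\theta\Big),$$ where the last integral converges absolutely. -/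

import Mathlib

open Set Filter Topology MeasureTheory
open scoped ENNReal

noncomputable section

namespace PoissonHeat

/-- The constant `κ_d = Γ((d+1)/2) / π^((d+1)/2)`. -/
def kappa (d : ℕ) : ℝ :=
  Real.Gamma (((d : ℝ) + 1) / 2) / Real.pi ^ (((d : ℝ) + 1) / 2)

/-- The surface area `A_d = 2 π^(d/2) / Γ(d/2)` of the unit sphere of `ℝ^d`. -/
def sphereArea (d : ℕ) : ℝ :=
  2 * Real.pi ^ ((d : ℝ) / 2) / Real.Gamma ((d : ℝ) / 2)

/-- The Poisson kernel `p_t(x) = κ_d t / (t² + |x|²)^((d+1)/2)`. -/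
def poissonKernel {d : ℕ} (t : ℝ) (x : EuclideanSpace ℝ (Fin d)) : ℝ :=
  kappa d * t / (t ^ 2 + ‖x‖ ^ 2) ^ (((d : ℝ) + 1) / 2)

/-- The heat content `H_Ω(t) = ∫_Ω ∫_Ω p_t(x - y) dy dx`. -/
def heatContent {d : ℕ} (Ω : Set (EuclideanSpace ℝ (Fin d))) (t : ℝ) : ℝ :=
  ∫ x in Ω, ∫ y in Ω, poissonKernel t (x - y)

/-- The divergence of a vector field on `ℝ^d`. -/
def divergence {d : ℕ} (φ : EuclideanSpace ℝ (Fin d) → EuclideanSpace ℝ (Fin d))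
    (x : EuclideanSpace ℝ (Fin d)) : ℝ :=
  ∑ i : Fin d, (fderiv ℝ φ x (EuclideanSpace.single i 1)) i

/-- The perimeter `sup {∫_Ω div φ : φ ∈ C¹_c(ℝ^d, ℝ^d), ‖φ‖_∞ ≤ 1}`, with values in `[0, ∞]`.
As `φ = 0` is admissible, truncating the integrals at `0` does not change the supremum. -/
def perimeter {d : ℕ} (Ω : Set (EuclideanSpace ℝ (Fin d))) : ℝ≥0∞ :=
  ⨆ φ ∈ {φ : EuclideanSpace ℝ (Fin d) → EuclideanSpace ℝ (Fin d) |
      ContDiff ℝ 1 φ ∧ HasCompactSupport φ ∧ ∀ x, ‖φ x‖ ≤ 1},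
    ENNReal.ofReal (∫ x in Ω, divergence φ x)

/-- The directional variation `V_u(Ω) = sup {∫_Ω ⟨∇φ, u⟩ : φ ∈ C¹_c(ℝ^d, ℝ), ‖φ‖_∞ ≤ 1}` of the
indicator function of `Ω` in `ℝ^d`, with values in `[0, ∞]`. -/
def dirVariation {d : ℕ} (Ω : Set (EuclideanSpace ℝ (Fin d)))
    (u : EuclideanSpace ℝ (Fin d)) : ℝ≥0∞ :=
  ⨆ φ ∈ {φ : EuclideanSpace ℝ (Fin d) → ℝ |
      ContDiff ℝ 1 φ ∧ HasCompactSupport φ ∧ ∀ x, ‖φ x‖ ≤ 1},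
    ENNReal.ofReal (∫ x in Ω, inner ℝ (gradient φ x) u)

/-- The set covariance function `g_Ω(y) = |Ω ∩ (Ω + y)|`. -/
def covariance {d : ℕ} (Ω : Set (EuclideanSpace ℝ (Fin d)))
    (y : EuclideanSpace ℝ (Fin d)) : ℝ :=
  volume.real (Ω ∩ (fun x => x + y) '' Ω)

/-- `ℓ_Ω = inf {ℓ > 0 : g_Ω(y) = 0 for all |y| ≥ ℓ}`. -/
def ell {d : ℕ} (Ω : Set (EuclideanSpace ℝ (Fin d))) : ℝ :=
  sInf {l : ℝ | 0 < l ∧ ∀ y : EuclideanSpace ℝ (Fin d), l ≤ ‖y‖ → covariance Ω y = 0}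

/-- `γ_Ω(s) = ∫_{S^{d-1}} (V_u(Ω)/2 - (g_Ω(0) - g_Ω(su))/s) dσ(u)`, where `σ` is the surface measure
of the unit sphere (of total mass `A_d`). -/
def gam {d : ℕ} (Ω : Set (EuclideanSpace ℝ (Fin d))) (s : ℝ) : ℝ :=
  ∫ u : Metric.sphere (0 : EuclideanSpace ℝ (Fin d)) 1,
    ((dirVariation Ω (u : EuclideanSpace ℝ (Fin d))).toReal / 2
      - (covariance Ω 0 - covariance Ω (s • (u : EuclideanSpace ℝ (Fin d)))) / s)
    ∂((volume : Measure (EuclideanSpace ℝ (Fin d))).toSphere)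

/-- The class `𝒲` of bounded Lebesgue measurable sets `Ω` of finite perimeter such that
`s ↦ s⁻¹ γ_Ω(ℓ_Ω s)` is integrable on `(0, 1)`. Positive measure is part of the class because `ℓ_Ω`
is only meaningful for such sets. -/
def classW (d : ℕ) : Set (Set (EuclideanSpace ℝ (Fin d))) :=
  {Ω | NullMeasurableSet Ω volume ∧ Bornology.IsBounded Ω ∧ 0 < volume Ω ∧ perimeter Ω < ∞ ∧
    IntegrableOn (fun s : ℝ => s⁻¹ * gam Ω (ell Ω * s)) (Ioo 0 1)}

end PoissonHeat

end

/-! Write `g` for the covariance, `ℓ` for `ell Ω`, and `w_t(r) = r^d / (t² + r²)^((d+1)/2)`. Since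
`p_t` has mass one, Fubini gives `|Ω| - H(t) = ∫ p_t(z) (g(0) - g(z)) dz`, which in polar
coordinates is `κ_d t ∫₀^∞ (w_t(r)/r) h(r) dr` with `h(r) = ∫_S (g(0) - g(ru)) dσ(u)`.

Beyond `ℓ` the covariance vanishes and `h = |Ω| A_d`. Below `ℓ`, the definition of `γ` says `h(r) =
r (½ ∫_S V_u dσ - γ(r))`, so no expansion of `g` near the origin is needed. The geometric input is
`∫_S V_u dσ = M · Per(Ω)` (`integral_sphere_dirVariation`), with `M = momentConst d` the integral of
`|⟨e, u⟩|` over the sphere for a unit vector `e`. It needs no structure theory of sets of finite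
perimeter: `V_u` and `Per` are limits of the `L¹` norms of the directional and full derivatives of
the mollified indicator, and for those the identity is Tonelli plus the moment formula on the
sphere.

This yields the exact formula `heatContent_deficit_eq`, whose three terms are handled separately.
The outer and `γ` terms converge by dominated convergence, thanks to `r w_t(r) ≤ 1`. In the
perimeter term the substitution `r = t sinh θ` turns `∫₀^ℓ w_t` into `∫ tanh^d` up to `arsinh(ℓ/t)`,
which grows like `ln(2ℓ/t)`. Finally `κ_d M / 2 = 1/π`. -/

noncomputable section

namespace PoissonHeat


open scoped Convolution

/-! ### Mollification of vector-valued maps. -/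

section Mollify

variable {E F : Type*} [NormedAddCommGroup E] [InnerProductSpace ℝ E] [FiniteDimensional ℝ E]
  [MeasurableSpace E] [BorelSpace E] [NormedAddCommGroup F] [NormedSpace ℝ F]

/-- The mollification of a vector-valued map. -/
def mollify (η : ContDiffBump (0 : E)) (φ : E → F) : E → F :=
  η.normed volume ⋆[ContinuousLinearMap.lsmul ℝ ℝ, volume] φ

/-- All smoothness comes from the bump, so merely continuous fields yield admissible `C¹`
competitors. -/
lemma contDiff_mollify (η : ContDiffBump (0 : E)) {φ : E → F} (hφ : Continuous φ) :
    ContDiff ℝ 1 (mollify η φ) :=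
  η.hasCompactSupport_normed.contDiff_convolution_left (n := 1) _ η.contDiff_normed
    hφ.locallyIntegrable

lemma hasCompactSupport_mollify (η : ContDiffBump (0 : E)) {φ : E → F}
    (hφ : HasCompactSupport φ) : HasCompactSupport (mollify η φ) :=
  η.hasCompactSupport_normed.convolution _ hφ

lemma norm_mollify_le (η : ContDiffBump (0 : E)) {φ : E → F} {C : ℝ} (hφ : ∀ x, ‖φ x‖ ≤ C)
    (x : E) : ‖mollify η φ x‖ ≤ C := by
  rw [mollify, convolution_def]
  refine (norm_integral_le_of_norm_le (g := fun t => η.normed volume t * C)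
    (η.integrable_normed.mul_const C) (Eventually.of_forall fun t => ?_)).trans ?_
  · simp only [ContinuousLinearMap.lsmul_apply, norm_smul, Real.norm_of_nonneg (η.nonneg_normed t)]
    exact mul_le_mul_of_nonneg_left (hφ _) (η.nonneg_normed t)
  · rw [integral_mul_const, η.integral_normed, one_mul]

/-- The derivative falls on `φ`, the form suited to letting the bump shrink; `fderiv_mollify` puts
it on the bump instead. -/
lemma fderiv_mollify_of_contDiff (η : ContDiffBump (0 : E)) {φ : E → F} (hφ : ContDiff ℝ 1 φ)
    (hφc : HasCompactSupport φ) (x : E) :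
    fderiv ℝ (mollify η φ) x = mollify η (fderiv ℝ φ) x := by
  rw [mollify, (hφc.hasFDerivAt_convolution_right _ η.continuous_normed.locallyIntegrable
    hφ x).fderiv]
  rfl

end Mollify

/-! ### Variations as limits of `L¹` norms of smooth densities. -/

section Mollification

variable {E F : Type*} [NormedAddCommGroup E] [InnerProductSpace ℝ E] [FiniteDimensional ℝ E]
  [MeasurableSpace E] [BorelSpace E]
  [NormedAddCommGroup F] [InnerProductSpace ℝ F] [FiniteDimensional ℝ F]

/-- The supremum of `∫_Ω L (Dφ)` over `C¹_c` maps `φ` bounded by one. -/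
def jacobianVariation (Ω : Set E) (L : (E →L[ℝ] F) →L[ℝ] ℝ) : ℝ≥0∞ :=
  ⨆ φ ∈ {φ : E → F | ContDiff ℝ 1 φ ∧ HasCompactSupport φ ∧ ∀ x, ‖φ x‖ ≤ 1},
    ENNReal.ofReal (∫ x in Ω, L (fderiv ℝ φ x))

/-- Minus the derivative of the mollified indicator function of `Ω`. -/
def smearedDeriv (Ω : Set E) (η : ContDiffBump (0 : E)) (y : E) : E →L[ℝ] ℝ :=
  ∫ x in Ω, fderiv ℝ (η.normed volume) (x - y)

/-- The vector field representing `φ ↦ ∫_Ω L (D(η ⋆ φ))`. -/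
def smearedDensity (Ω : Set E) (L : (E →L[ℝ] F) →L[ℝ] ℝ) (η : ContDiffBump (0 : E)) (y : E) : F :=
  (InnerProductSpace.toDual ℝ F).symm
    (L ∘L ContinuousLinearMap.smulRightL ℝ E F (smearedDeriv Ω η y))

lemma inner_smearedDensity (Ω : Set E) (L : (E →L[ℝ] F) →L[ℝ] ℝ) (η : ContDiffBump (0 : E))
    (y : E) (v : F) :
    inner ℝ (smearedDensity Ω L η y) v = L ((smearedDeriv Ω η y).smulRight v) := by
  simp [smearedDensity]

lemma norm_smearedDensity (Ω : Set E) (L : (E →L[ℝ] F) →L[ℝ] ℝ) (η : ContDiffBump (0 : E))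
    (y : E) : ‖smearedDensity Ω L η y‖ =
      ‖L ∘L ContinuousLinearMap.smulRightL ℝ E F (smearedDeriv Ω η y)‖ := by
  simp [smearedDensity]

lemma contDiff_normed_bump (η : ContDiffBump (0 : E)) : ContDiff ℝ 1 (η.normed volume) :=
  η.contDiff_normed

lemma continuous_fderiv_bump (η : ContDiffBump (0 : E)) :
    Continuous (fderiv ℝ (η.normed volume)) :=
  (contDiff_normed_bump η).continuous_fderiv one_ne_zero

lemma hasCompactSupport_fderiv_bump (η : ContDiffBump (0 : E)) :
    HasCompactSupport (fderiv ℝ (η.normed (volume : Measure E))) :=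
  η.hasCompactSupport_normed.fderiv ℝ

lemma continuous_smearedDeriv {Ω : Set E} (hΩ : volume Ω ≠ ∞) (η : ContDiffBump (0 : E)) :
    Continuous (smearedDeriv Ω η) := by
  have : IsFiniteMeasure (volume.restrict Ω) := ⟨by simpa using hΩ.lt_top⟩
  obtain ⟨C, hC⟩ := (hasCompactSupport_fderiv_bump η).exists_bound_of_continuous
    (continuous_fderiv_bump η)
  have hc := continuous_fderiv_bump η
  refine continuous_of_dominated (bound := fun _ => C) (fun y => ?_)
    (fun y => Eventually.of_forall fun x => hC _) (integrable_const _)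
    (Eventually.of_forall fun x => by fun_prop)
  exact (hc.comp (continuous_id.sub continuous_const)).aestronglyMeasurable

lemma hasCompactSupport_smearedDeriv {Ω : Set E} (hΩ : Bornology.IsBounded Ω)
    (η : ContDiffBump (0 : E)) : HasCompactSupport (smearedDeriv Ω η) := by
  obtain ⟨R, hR⟩ := hΩ.subset_closedBall 0
  obtain ⟨S, hS⟩ := (hasCompactSupport_fderiv_bump η).isCompact.isBounded.subset_closedBall 0
  refine HasCompactSupport.intro (isCompact_closedBall (0 : E) (R + S)) fun y hy => ?_
  refine setIntegral_eq_zero_of_forall_eq_zero fun x hx => ?_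
  by_contra h
  have h1 := hS (subset_tsupport _ (show x - y ∈ Function.support _ from h))
  have h2 := hR hx
  simp only [mem_closedBall_zero_iff] at h1 h2 hy
  have := norm_sub_le x (x - y)
  simp at this
  linarith

lemma continuous_smearedDensity {Ω : Set E} (hΩ : volume Ω ≠ ∞) (L : (E →L[ℝ] F) →L[ℝ] ℝ)
    (η : ContDiffBump (0 : E)) : Continuous (smearedDensity Ω L η) := by
  have := continuous_smearedDeriv hΩ η
  unfold smearedDensity
  fun_prop

lemma hasCompactSupport_smearedDensity {Ω : Set E} (hΩ : Bornology.IsBounded Ω)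
    (L : (E →L[ℝ] F) →L[ℝ] ℝ) (η : ContDiffBump (0 : E)) :
    HasCompactSupport (smearedDensity Ω L η) :=
  (hasCompactSupport_smearedDeriv hΩ η).comp_left
    (g := fun T => (InnerProductSpace.toDual ℝ F).symm
      (L ∘L ContinuousLinearMap.smulRightL ℝ E F T)) (by simp)

lemma fderiv_mollify (η : ContDiffBump (0 : E)) {φ : E → F} (hφ : Continuous φ) (x : E) :
    fderiv ℝ (mollify η φ) x =
      ∫ y, (fderiv ℝ (η.normed volume) (x - y)).smulRight (φ y) := by
  rw [mollify, (η.hasCompactSupport_normed.hasFDerivAt_convolution_left _ (contDiff_normed_bump η)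
    hφ.locallyIntegrable x).fderiv, convolution_eq_swap]
  rfl

/-- With the derivative on the bump, both sides are iterated integrals of `L (Dη(x - y) ⊗ φ(y))`,
which is continuous with compact support, so Fubini applies. -/
lemma setIntegral_fderiv_mollify {Ω : Set E} (hΩ : Bornology.IsBounded Ω)
    (L : (E →L[ℝ] F) →L[ℝ] ℝ) (η : ContDiffBump (0 : E)) {φ : E → F} (hφ : Continuous φ)
    (hφc : HasCompactSupport φ) :
    ∫ x in Ω, L (fderiv ℝ (mollify η φ) x) = ∫ y, inner ℝ (smearedDensity Ω L η y) (φ y) := by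
  have hc := continuous_fderiv_bump η
  have hcs := hasCompactSupport_fderiv_bump η
  have : IsFiniteMeasure (volume.restrict Ω) := ⟨by simpa using hΩ.measure_lt_top⟩
  have h1 : ∀ x, L (fderiv ℝ (mollify η φ) x) =
      ∫ y, L ((fderiv ℝ (η.normed volume) (x - y)).smulRight (φ y)) := fun x => by
    rw [fderiv_mollify η hφ, L.integral_comp_comm]
    refine Continuous.integrable_of_hasCompactSupport ?_ ?_
    · exact (ContinuousLinearMap.smulRightL ℝ E F).continuous₂.comp
        ((hc.comp (continuous_const.sub continuous_id)).prodMk hφ)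
    · exact hφc.mono fun y hy h => hy (by simp [h])
  have h2 : ∀ y, inner ℝ (smearedDensity Ω L η y) (φ y) =
      ∫ x in Ω, L ((fderiv ℝ (η.normed volume) (x - y)).smulRight (φ y)) := fun y => by
    rw [inner_smearedDensity, smearedDeriv]
    change (L ∘L (ContinuousLinearMap.smulRightL ℝ E F).flip (φ y)) _ = _
    rw [← ContinuousLinearMap.integral_comp_comm]
    · rfl
    · have h : Continuous fun x => fderiv ℝ (η.normed volume) (x - y) := by fun_prop
      exact (h.integrable_of_hasCompactSupport
        (hcs.comp_homeomorph (Homeomorph.subRight y))).integrableOn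
  simp_rw [h1, h2]
  refine integral_integral_swap_of_hasCompactSupport ?_ ?_
  · have h : Continuous fun p : E × E =>
        ContinuousLinearMap.smulRightL ℝ E F (fderiv ℝ (η.normed volume) (p.1 - p.2)) (φ p.2) :=
      (ContinuousLinearMap.smulRightL ℝ E F).continuous₂.comp
        ((hc.comp (continuous_fst.sub continuous_snd)).prodMk (hφ.comp continuous_snd))
    exact L.continuous.comp h
  · obtain ⟨R, hR⟩ := hφc.isCompact.isBounded.subset_closedBall 0
    obtain ⟨S, hS⟩ := hcs.isCompact.isBounded.subset_closedBall 0
    refine HasCompactSupport.intro ((isCompact_closedBall (0 : E) (R + S)).prod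
      (isCompact_closedBall (0 : E) R)) fun p hp => ?_
    by_contra h
    have h1 : fderiv ℝ (η.normed volume) (p.1 - p.2) ≠ 0 := fun h' =>
      h (by simp [Function.uncurry, h'])
    have h2 : φ p.2 ≠ 0 := fun h' => h (by simp [Function.uncurry, h'])
    have h1 := hS (subset_tsupport _ (show p.1 - p.2 ∈ Function.support _ from h1))
    have h2 := hR (subset_tsupport _ (show p.2 ∈ Function.support _ from h2))
    simp only [mem_closedBall_zero_iff] at h1 h2
    refine hp ⟨?_, by simpa using h2⟩
    have := norm_add_le (p.1 - p.2) p.2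
    simp only [sub_add_cancel] at this
    simp only [mem_closedBall_zero_iff]
    linarith

/-- Duality between `L¹` and `L^∞`: the best test field is `G/‖G‖`, and its mollification is a
competitor of norm at most one. Fatou's lemma removes the regularisation of `G/‖G‖`. -/
lemma lintegral_smearedDensity_le {Ω : Set E} (hΩ : Bornology.IsBounded Ω)
    (L : (E →L[ℝ] F) →L[ℝ] ℝ) (η : ContDiffBump (0 : E)) :
    ∫⁻ y, ‖smearedDensity Ω L η y‖ₑ ≤ jacobianVariation Ω L := by
  set G := smearedDensity Ω L η with hG
  have hGc : Continuous G := continuous_smearedDensity hΩ.measure_lt_top.ne L η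
  have hGs : HasCompactSupport G := hasCompactSupport_smearedDensity hΩ L η
  -- The term `1/(n+1)` keeps `ψ n • G` continuous at the zeros of `G` and its norm at most one.
  set ψ : ℕ → E → ℝ := fun n y => (√(‖G y‖ ^ 2 + 1 / ((n : ℝ) + 1)))⁻¹ with hψ
  have hpos : ∀ (n : ℕ) y, 0 < ‖G y‖ ^ 2 + 1 / ((n : ℝ) + 1) := fun n y => by positivity
  have hψc : ∀ n, Continuous (ψ n) := fun n => by
    refine Continuous.inv₀ (by fun_prop) fun y => (Real.sqrt_pos.2 (hpos n y)).ne'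
  have hval : ∀ n y, inner ℝ (G y) (ψ n y • G y) = ψ n y * ‖G y‖ ^ 2 := fun n y => by
    rw [inner_smul_right, real_inner_self_eq_norm_sq]
  have hle : ∀ n, ∫⁻ y, ENNReal.ofReal (ψ n y * ‖G y‖ ^ 2) ≤ jacobianVariation Ω L := fun n => by
    have hφc : Continuous fun y => ψ n y • G y := (hψc n).smul hGc
    have hφs : HasCompactSupport fun y => ψ n y • G y := hGs.smul_left
    have hφ1 : ∀ y, ‖ψ n y • G y‖ ≤ 1 := fun y => by
      rw [norm_smul, hψ]
      simp only
      rw [norm_inv, Real.norm_of_nonneg (Real.sqrt_nonneg _),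
        inv_mul_le_one₀ (Real.sqrt_pos.2 (hpos n y))]
      exact Real.le_sqrt_of_sq_le (by linarith [show 0 < 1 / ((n : ℝ) + 1) by positivity])
    rw [← ofReal_integral_eq_lintegral_ofReal]
    · simp_rw [← hval n]
      rw [hG, ← setIntegral_fderiv_mollify hΩ L η hφc hφs]
      exact le_iSup₂_of_le (mollify η fun y => ψ n y • G y)
        ⟨contDiff_mollify η hφc, hasCompactSupport_mollify η hφs, norm_mollify_le η hφ1⟩ le_rfl
    · refine Continuous.integrable_of_hasCompactSupport ((hψc n).mul (hGc.norm.pow 2)) ?_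
      exact hGs.mono fun y hy h => hy (by simp [h])
    · exact Eventually.of_forall fun y => by simp only [hψ, Pi.zero_apply]; positivity
  have hlim : ∀ y, Tendsto (fun n => ENNReal.ofReal (ψ n y * ‖G y‖ ^ 2)) atTop (𝓝 ‖G y‖ₑ) :=
    fun y => by
    rw [← ofReal_norm]
    refine ENNReal.tendsto_ofReal ?_
    rcases eq_or_ne (G y) 0 with h | h
    · simp [h]
    · have h0 : 0 < ‖G y‖ := norm_pos_iff.2 h
      have h1 : Tendsto (fun n : ℕ => ‖G y‖ ^ 2 + 1 / ((n : ℝ) + 1)) atTop (𝓝 (‖G y‖ ^ 2 + 0)) :=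
        tendsto_one_div_add_atTop_nhds_zero_nat.const_add _
      have h2 := ((Real.continuous_sqrt.tendsto _).comp h1).inv₀ (by
        simp [Real.sqrt_sq h0.le, h])
      refine (h2.mul_const (‖G y‖ ^ 2)).trans (le_of_eq ?_)
      rw [add_zero, Real.sqrt_sq h0.le]
      field_simp
  calc ∫⁻ y, ‖G y‖ₑ = ∫⁻ y, liminf (fun n => ENNReal.ofReal (ψ n y * ‖G y‖ ^ 2)) atTop :=
        lintegral_congr fun y => (hlim y).liminf_eq.symm
    _ ≤ liminf (fun n => ∫⁻ y, ENNReal.ofReal (ψ n y * ‖G y‖ ^ 2)) atTop :=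
        lintegral_liminf_le fun n => (((hψc n).mul (hGc.norm.pow 2)).measurable).ennreal_ofReal
    _ ≤ jacobianVariation Ω L := liminf_le_of_le (by isBoundedDefault) fun b hb => by
        obtain ⟨n, hn⟩ := hb.exists
        exact hn.trans (hle n)

lemma tendsto_setIntegral_fderiv_mollify {Ω : Set E} (hΩ : Bornology.IsBounded Ω)
    (L : (E →L[ℝ] F) →L[ℝ] ℝ) {η : ℕ → ContDiffBump (0 : E)}
    (hη : Tendsto (fun n => (η n).rOut) atTop (𝓝 0)) {φ : E → F} (hφ : ContDiff ℝ 1 φ)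
    (hφc : HasCompactSupport φ) :
    Tendsto (fun n => ∫ x in Ω, L (fderiv ℝ (mollify (η n) φ) x)) atTop
      (𝓝 (∫ x in Ω, L (fderiv ℝ φ x))) := by
  have : IsFiniteMeasure (volume.restrict Ω) := ⟨by simpa using hΩ.measure_lt_top⟩
  have hc : Continuous (fderiv ℝ φ) := hφ.continuous_fderiv one_ne_zero
  obtain ⟨C, hC⟩ := (hφc.fderiv ℝ).exists_bound_of_continuous hc
  simp_rw [fun n => fderiv_mollify_of_contDiff (η n) hφ hφc]
  refine tendsto_integral_of_dominated_convergence (fun _ => ‖L‖ * C) (fun n => ?_)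
    (integrable_const _) (fun n => Eventually.of_forall fun x => ?_)
    (Eventually.of_forall fun x => ?_)
  · exact (L.continuous.comp (contDiff_mollify (η n) hc).continuous).aestronglyMeasurable
  · have h : ‖mollify (η n) (fderiv ℝ φ) x‖ ≤ C := norm_mollify_le (η n) hC x
    exact (L.le_opNorm _).trans (by gcongr)
  · exact (L.continuous.tendsto _).comp
      (ContDiffBump.convolution_tendsto_right_of_continuous hη hc x)

/-- The variation is the limit of the `L¹` norms of the smeared densities. -/
lemma tendsto_lintegral_smearedDensity {Ω : Set E} (hΩ : Bornology.IsBounded Ω)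
    (L : (E →L[ℝ] F) →L[ℝ] ℝ) {η : ℕ → ContDiffBump (0 : E)}
    (hη : Tendsto (fun n => (η n).rOut) atTop (𝓝 0)) :
    Tendsto (fun n => ∫⁻ y, ‖smearedDensity Ω L (η n) y‖ₑ) atTop (𝓝 (jacobianVariation Ω L)) := by
  refine tendsto_of_le_liminf_of_limsup_le ?_ ?_
  -- The value at a competitor `φ` is the limit of `∫ ⟨G_n, φ⟩ ≤ ∫ ‖G_n‖`.
  · refine iSup₂_le fun φ ⟨hφ, hφc, hφ1⟩ => ?_
    have h := ENNReal.tendsto_ofReal (tendsto_setIntegral_fderiv_mollify hΩ L hη hφ hφc)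
    rw [← h.liminf_eq]
    refine liminf_le_liminf (Eventually.of_forall fun n => ?_)
    rw [setIntegral_fderiv_mollify hΩ L (η n) hφ.continuous hφc]
    refine (ENNReal.ofReal_le_ofReal (le_abs_self _)).trans ?_
    rw [← Real.norm_eq_abs, ofReal_norm]
    refine (enorm_integral_le_lintegral_enorm _).trans (lintegral_mono fun y => ?_)
    rw [← ofReal_norm, ← ofReal_norm]
    refine ENNReal.ofReal_le_ofReal ((norm_inner_le_norm _ _).trans ?_)
    exact mul_le_of_le_one_right (norm_nonneg _) (hφ1 y)
  · refine limsup_le_of_le (by isBoundedDefault) (Eventually.of_forall fun n => ?_)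
    exact lintegral_smearedDensity_le hΩ L (η n)

end Mollification


/-! ### Polar coordinates and one-dimensional Gaussian moments. -/

section Polar

variable {E : Type*} [NormedAddCommGroup E] [NormedSpace ℝ E] [Nontrivial E]
  [FiniteDimensional ℝ E] [MeasurableSpace E] [BorelSpace E]

/-- Integration in polar coordinates. -/
lemma integral_polar (μ : Measure E) [μ.IsAddHaarMeasure] {f : E → ℝ} (hf : Integrable f μ) :
    ∫ x, f x ∂μ = ∫ r in Ioi (0 : ℝ), r ^ (Module.finrank ℝ E - 1) *
      ∫ u : Metric.sphere (0 : E) 1, f (r • (u : E)) ∂μ.toSphere := by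
  have hmp := μ.measurePreserving_homeomorphUnitSphereProd
  have hemb := (homeomorphUnitSphereProd E).measurableEmbedding
  set g : Metric.sphere (0 : E) 1 × Ioi (0 : ℝ) → ℝ := fun p => f ((p.2 : ℝ) • (p.1 : E)) with hg
  have hgf : ∀ x : ({0}ᶜ : Set E), g (homeomorphUnitSphereProd E x) = f x := fun x => by
    have := homeomorphUnitSphereProd_symm_apply_coe E (homeomorphUnitSphereProd E x)
    rw [Homeomorph.symm_apply_apply] at this
    rw [hg, this]
  have hint : Integrable g (μ.toSphere.prod (.volumeIoiPow (Module.finrank ℝ E - 1))) := by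
    rw [← hmp.integrable_comp_emb hemb]
    have h1 : IntegrableOn f ({0}ᶜ : Set E) μ := hf.integrableOn
    rw [integrableOn_iff_comap_subtypeVal (by measurability)] at h1
    exact h1.congr (Eventually.of_forall fun x => (hgf x).symm)
  calc ∫ x, f x ∂μ = ∫ x : ({(0)}ᶜ : Set E), f x.1 ∂(μ.comap (↑)) := by
        rw [integral_subtype_comap (measurableSet_singleton _).compl f, restrict_compl_singleton]
    _ = ∫ p, g p ∂μ.toSphere.prod (.volumeIoiPow (Module.finrank ℝ E - 1)) := by
        rw [← hmp.integral_comp hemb]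
        exact integral_congr_ae (Eventually.of_forall fun x => (hgf x).symm)
    _ = ∫ r : Ioi (0 : ℝ), ∫ u, g (u, r) ∂μ.toSphere
          ∂.volumeIoiPow (Module.finrank ℝ E - 1) := integral_prod_symm _ hint
    _ = _ := by
        simp only [Measure.volumeIoiPow, ENNReal.ofReal]
        rw [integral_withDensity_eq_integral_smul,
          integral_subtype_comap measurableSet_Ioi fun a : ℝ =>
            Real.toNNReal (a ^ (Module.finrank ℝ E - 1)) •
              ∫ u : Metric.sphere (0 : E) 1, f (a • (u : E)) ∂μ.toSphere]
        · refine setIntegral_congr_fun measurableSet_Ioi fun x hx => ?_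
          simp only [NNReal.smul_def, Real.coe_toNNReal _ (pow_nonneg (le_of_lt hx) _), smul_eq_mul]
        · exact (measurable_subtype_coe.pow_const _).real_toNNReal

end Polar

lemma integral_exp_neg_sq : ∫ s : ℝ, Real.exp (-s ^ 2) = √Real.pi := by
  simpa using integral_gaussian 1

lemma integral_abs_mul_exp_neg_sq : ∫ s : ℝ, |s| * Real.exp (-s ^ 2) = 1 := by
  have h := integral_comp_abs (f := fun s => s * Real.exp (-s ^ 2))
  simp only [sq_abs] at h
  have h2 := integral_rpow_mul_exp_neg_rpow (p := 2) (q := 1) (by norm_num) (by norm_num)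
  norm_num at h2
  rw [h, h2]; norm_num

lemma integrable_abs_mul_exp_neg_sq : Integrable fun s : ℝ => |s| * Real.exp (-s ^ 2) :=
  .of_integral_ne_zero (by rw [integral_abs_mul_exp_neg_sq]; norm_num)

/-! ### First absolute moment of a linear functional on the sphere. -/

section Sphere

variable {d : ℕ}

local notation "𝔼" => EuclideanSpace ℝ (Fin d)

/-- A rotation sends the Riesz vector of `H` to the first axis, so that the Gaussian integral of
`|H|` splits into one-dimensional ones. -/
lemma exists_orthonormalBasis_dual (hd : 0 < d) (H : 𝔼 →L[ℝ] ℝ) :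
    ∃ (b : OrthonormalBasis (Fin d) ℝ 𝔼), ∀ y : 𝔼, |H (b.repr.symm y)| = ‖H‖ * |y ⟨0, hd⟩| := by
  set w := (InnerProductSpace.toDual ℝ 𝔼).symm H with hw
  have hHw : ∀ y, H y = inner ℝ w y := fun y => by simp [hw]
  have hnorm : ‖w‖ = ‖H‖ := by simp [hw]
  rcases eq_or_ne w 0 with h0 | h0
  · refine ⟨EuclideanSpace.basisFun _ ℝ, fun y => ?_⟩
    rw [← hnorm, hHw]; simp [h0]
  · obtain ⟨b, hb⟩ := Orthonormal.exists_orthonormalBasis_extension_of_card_eq (𝕜 := ℝ) 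
      (ι := Fin d) (by simp) (v := fun _ => ‖w‖⁻¹ • w) (s := {⟨0, hd⟩}) (by
        refine ⟨fun i => ?_, fun i j hij => (hij (Subsingleton.elim _ _)).elim⟩
        simp [norm_smul, h0])
    have hb0 := hb ⟨0, hd⟩ rfl
    have hwb : w = ‖w‖ • b ⟨0, hd⟩ := by
      rw [hb0, smul_smul, mul_inv_cancel₀ (norm_ne_zero_iff.2 h0), one_smul]
    refine ⟨b, fun y => ?_⟩
    rw [hHw, hwb, inner_smul_left, ← b.repr_apply_apply, abs_mul]
    simp [hnorm]

/-- The factors of the Gaussian weight with first absolute moment in the first variable. -/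
def gaussFactor (hd : 0 < d) (i : Fin d) (s : ℝ) : ℝ :=
  if i = ⟨0, hd⟩ then |s| * Real.exp (-s ^ 2) else Real.exp (-s ^ 2)

lemma prod_gaussFactor (hd : 0 < d) (y : 𝔼) :
    ∏ i, gaussFactor hd i (y i) = |y ⟨0, hd⟩| * Real.exp (-‖y‖ ^ 2) := by
  have h : ∀ i, gaussFactor hd i (y i) =
      (if i = ⟨0, hd⟩ then |y ⟨0, hd⟩| else 1) * Real.exp (-(y i) ^ 2) := fun i => by
    unfold gaussFactor
    split_ifs with h
    · rw [h]
    · rw [one_mul]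
  simp_rw [h, Finset.prod_mul_distrib, ← Real.exp_sum, EuclideanSpace.norm_sq_eq,
    Finset.sum_neg_distrib]
  simp

lemma integrable_gaussFactor (hd : 0 < d) (i : Fin d) : Integrable (gaussFactor hd i) := by
  unfold gaussFactor
  split_ifs
  · exact integrable_abs_mul_exp_neg_sq
  · simpa using integrable_exp_neg_mul_sq one_pos

lemma integral_gaussFactor_prod (hd : 0 < d) :
    ∏ i, ∫ s, gaussFactor hd i s = Real.pi ^ (((d : ℝ) - 1) / 2) := by
  have h : ∀ i, ∫ s, gaussFactor hd i s = if i = ⟨0, hd⟩ then 1 else √Real.pi := fun i => by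
    unfold gaussFactor
    split_ifs
    · exact integral_abs_mul_exp_neg_sq
    · exact integral_exp_neg_sq
  simp_rw [h, Finset.prod_ite, Finset.prod_const_one, Finset.prod_const, one_mul]
  rw [Finset.filter_ne' Finset.univ, Finset.card_erase_of_mem (Finset.mem_univ _)]
  rw [Finset.card_univ, Fintype.card_fin, Real.sqrt_eq_rpow, ← Real.rpow_natCast,
    ← Real.rpow_mul Real.pi_pos.le, Nat.cast_sub hd]
  congr 1; push_cast; ring

lemma integrable_dual_mul_exp (hd : 0 < d) (H : 𝔼 →L[ℝ] ℝ) :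
    Integrable fun x : 𝔼 => |H x| * Real.exp (-‖x‖ ^ 2) := by
  obtain ⟨b, hb⟩ := exists_orthonormalBasis_dual hd H
  rw [← b.measurePreserving_repr_symm.integrable_comp_emb
    b.repr.symm.toHomeomorph.measurableEmbedding,
    ← (PiLp.volume_preserving_toLp (Fin d)).integrable_comp_emb
    (MeasurableEquiv.toLp 2 _).measurableEmbedding]
  have := (Integrable.fintype_prod fun i => integrable_gaussFactor hd i).const_mul ‖H‖
  refine this.congr (Eventually.of_forall fun y => ?_)
  have h := prod_gaussFactor hd (WithLp.toLp 2 y)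
  simp only at h
  simp only [Function.comp_apply, hb, LinearIsometryEquiv.norm_map]
  rw [h, mul_assoc]

lemma integral_dual_mul_exp (hd : 0 < d) (H : 𝔼 →L[ℝ] ℝ) :
    ∫ x : 𝔼, |H x| * Real.exp (-‖x‖ ^ 2) = ‖H‖ * Real.pi ^ (((d : ℝ) - 1) / 2) := by
  obtain ⟨b, hb⟩ := exists_orthonormalBasis_dual hd H
  rw [← b.measurePreserving_repr_symm.integral_comp
    b.repr.symm.toHomeomorph.measurableEmbedding,
    ← (PiLp.volume_preserving_toLp (Fin d)).integral_comp
    (MeasurableEquiv.toLp 2 _).measurableEmbedding, ← integral_gaussFactor_prod hd,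
    ← integral_fintype_prod_volume_eq_prod, ← integral_const_mul]
  refine integral_congr_ae (Eventually.of_forall fun y => ?_)
  have h := prod_gaussFactor hd (WithLp.toLp 2 y)
  simp only at h
  simp only [hb, LinearIsometryEquiv.norm_map]
  rw [h, mul_assoc]

/-- The first absolute moment of a linear functional on the unit sphere. -/
lemma integral_sphere_abs_dual (hd : 0 < d) (H : 𝔼 →L[ℝ] ℝ) :
    ∫ u : Metric.sphere (0 : 𝔼) 1, |H u| ∂(volume : Measure 𝔼).toSphere =
      2 * Real.pi ^ (((d : ℝ) - 1) / 2) / Real.Gamma (((d : ℝ) + 1) / 2) * ‖H‖ := by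
  have : NeZero d := ⟨hd.ne'⟩
  set I := ∫ u : Metric.sphere (0 : 𝔼) 1, |H u| ∂(volume : Measure 𝔼).toSphere with hI
  -- The Gaussian integral of `|H|` is known from Cartesian coordinates; in polar coordinates it is
  -- `½ Γ((d+1)/2)` times the wanted moment.
  have h1 := integral_polar volume (integrable_dual_mul_exp hd H)
  rw [integral_dual_mul_exp hd H] at h1
  have h2 : ∫ r in Ioi (0 : ℝ), r ^ (Module.finrank ℝ 𝔼 - 1) *
      ∫ u : Metric.sphere (0 : 𝔼) 1, |H (r • (u : 𝔼))| * Real.exp (-‖r • (u : 𝔼)‖ ^ 2)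
        ∂(volume : Measure 𝔼).toSphere =
      ∫ r in Ioi (0 : ℝ), (r ^ (d : ℝ) * Real.exp (-r ^ (2 : ℝ))) * I := by
    refine setIntegral_congr_fun measurableSet_Ioi fun r (hr : 0 < r) => ?_
    have h3 : ∀ u : Metric.sphere (0 : 𝔼) 1,
        |H (r • (u : 𝔼))| * Real.exp (-‖r • (u : 𝔼)‖ ^ 2) = r * Real.exp (-r ^ 2) * |H u| := by
      intro u
      simp only [map_smul, smul_eq_mul, abs_mul, norm_smul, norm_eq_of_mem_sphere, mul_one,
        Real.norm_eq_abs, abs_of_pos hr]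
      ring
    simp only [h3, integral_const_mul, finrank_euclideanSpace, Fintype.card_fin]
    rw [← hI, Real.rpow_natCast, Real.rpow_two, ← mul_assoc, ← mul_assoc, ← pow_succ,
      Nat.sub_add_cancel hd]
  rw [h2, integral_mul_const, integral_rpow_mul_exp_neg_rpow (by norm_num)
    (by linarith [show (0 : ℝ) ≤ d from Nat.cast_nonneg d])] at h1
  have h4 : 0 < Real.Gamma (((d : ℝ) + 1) / 2) := Real.Gamma_pos_of_pos (by positivity)
  field_simp
  field_simp at h1
  linarith

end Sphere


/-! ### Perimeter as a spherical average of directional variations. -/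

section DirectionalVariation

variable {d : ℕ}

local notation "𝔼" => EuclideanSpace ℝ (Fin d)

lemma exists_shrinking_bumps :
    ∃ η : ℕ → ContDiffBump (0 : 𝔼), Tendsto (fun n => (η n).rOut) atTop (𝓝 0) :=
  ⟨fun n => ⟨1 / ((n : ℝ) + 1) / 2, 1 / ((n : ℝ) + 1), by positivity,
    half_lt_self (by positivity)⟩, tendsto_one_div_add_atTop_nhds_zero_nat⟩

/-- The trace as a functional on linear maps. -/
def traceFunctional (d : ℕ) :
    (EuclideanSpace ℝ (Fin d) →L[ℝ] EuclideanSpace ℝ (Fin d)) →L[ℝ] ℝ :=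
  ∑ i : Fin d, (EuclideanSpace.proj i : EuclideanSpace ℝ (Fin d) →L[ℝ] ℝ) ∘L
    ContinuousLinearMap.apply ℝ (EuclideanSpace ℝ (Fin d)) (EuclideanSpace.single i (1 : ℝ))

lemma traceFunctional_apply (A : 𝔼 →L[ℝ] 𝔼) :
    traceFunctional d A = ∑ i, (A (EuclideanSpace.single i 1)) i := by
  simp [traceFunctional]

lemma perimeter_eq_jacobianVariation (Ω : Set 𝔼) :
    perimeter Ω = jacobianVariation Ω (traceFunctional d) := by
  simp_rw [perimeter, jacobianVariation, traceFunctional_apply, divergence]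

lemma dirVariation_eq_jacobianVariation (Ω : Set 𝔼) (u : 𝔼) :
    dirVariation Ω u = jacobianVariation Ω (ContinuousLinearMap.apply ℝ ℝ u) := by
  simp [dirVariation, jacobianVariation, gradient]

/-- The trace of the rank-one map `T ⊗ v` is `T v`, so the density represents `T = smearedDeriv Ω η
y` itself. -/
lemma norm_smearedDensity_trace (Ω : Set 𝔼) (η : ContDiffBump (0 : 𝔼)) (y : 𝔼) :
    ‖smearedDensity Ω (traceFunctional d) η y‖ = ‖smearedDeriv Ω η y‖ := by
  rw [norm_smearedDensity]
  congr 1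
  ext v
  have hv : v = ∑ i, v i • EuclideanSpace.single i (1 : ℝ) := by
    simpa using ((EuclideanSpace.basisFun (Fin d) ℝ).sum_repr v).symm
  conv_rhs => rw [hv, map_sum]
  simp [traceFunctional_apply, mul_comm]

lemma norm_smearedDensity_apply (Ω : Set 𝔼) (η : ContDiffBump (0 : 𝔼)) (u y : 𝔼) :
    ‖smearedDensity Ω (ContinuousLinearMap.apply ℝ ℝ u) η y‖ = ‖smearedDeriv Ω η y u‖ := by
  have h := inner_smearedDensity Ω (ContinuousLinearMap.apply ℝ ℝ u) η y (1 : ℝ)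
  simp at h
  rw [h]

lemma tendsto_lintegral_perimeter {Ω : Set 𝔼} (hΩ : Bornology.IsBounded Ω)
    {η : ℕ → ContDiffBump (0 : 𝔼)} (hη : Tendsto (fun n => (η n).rOut) atTop (𝓝 0)) :
    Tendsto (fun n => ∫⁻ y, ‖smearedDeriv Ω (η n) y‖ₑ) atTop (𝓝 (perimeter Ω)) := by
  rw [perimeter_eq_jacobianVariation]
  refine (tendsto_lintegral_smearedDensity hΩ (traceFunctional d) hη).congr fun n => ?_
  refine lintegral_congr fun y => ?_
  rw [← ofReal_norm, norm_smearedDensity_trace, ofReal_norm]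

lemma tendsto_lintegral_dirVariation {Ω : Set 𝔼} (hΩ : Bornology.IsBounded Ω)
    {η : ℕ → ContDiffBump (0 : 𝔼)} (hη : Tendsto (fun n => (η n).rOut) atTop (𝓝 0)) (u : 𝔼) :
    Tendsto (fun n => ∫⁻ y, ‖smearedDeriv Ω (η n) y u‖ₑ) atTop (𝓝 (dirVariation Ω u)) := by
  rw [dirVariation_eq_jacobianVariation]
  refine (tendsto_lintegral_smearedDensity hΩ (ContinuousLinearMap.apply ℝ ℝ u) hη).congr
    fun n => ?_
  refine lintegral_congr fun y => ?_
  rw [← ofReal_norm, norm_smearedDensity_apply, ofReal_norm]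

lemma lintegral_smearedDeriv_le_perimeter {Ω : Set 𝔼} (hΩ : Bornology.IsBounded Ω)
    (η : ContDiffBump (0 : 𝔼)) : ∫⁻ y, ‖smearedDeriv Ω η y‖ₑ ≤ perimeter Ω := by
  rw [perimeter_eq_jacobianVariation]
  refine le_trans (le_of_eq (lintegral_congr fun y => ?_))
    (lintegral_smearedDensity_le hΩ (traceFunctional d) η)
  rw [← ofReal_norm, ← norm_smearedDensity_trace, ofReal_norm]

lemma lintegral_smearedDeriv_apply_le_perimeter {Ω : Set 𝔼} (hΩ : Bornology.IsBounded Ω)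
    (η : ContDiffBump (0 : 𝔼)) {u : 𝔼} (hu : ‖u‖ ≤ 1) :
    ∫⁻ y, ‖smearedDeriv Ω η y u‖ₑ ≤ perimeter Ω := by
  refine (lintegral_mono fun y => ?_).trans (lintegral_smearedDeriv_le_perimeter hΩ η)
  rw [← ofReal_norm, ← ofReal_norm]
  refine ENNReal.ofReal_le_ofReal (((smearedDeriv Ω η y).le_opNorm u).trans ?_)
  exact mul_le_of_le_one_right (norm_nonneg _) hu

lemma dirVariation_le_perimeter {Ω : Set 𝔼} (hΩ : Bornology.IsBounded Ω) {u : 𝔼}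
    (hu : ‖u‖ ≤ 1) : dirVariation Ω u ≤ perimeter Ω := by
  obtain ⟨η, hη⟩ := exists_shrinking_bumps (d := d)
  exact le_of_tendsto (tendsto_lintegral_dirVariation hΩ hη u)
    (Eventually.of_forall fun n => lintegral_smearedDeriv_apply_le_perimeter hΩ (η n) hu)

lemma measurable_enorm_smearedDeriv_apply {Ω : Set 𝔼} (hΩ : Bornology.IsBounded Ω)
    (η : ContDiffBump (0 : 𝔼)) : Measurable fun p : 𝔼 × 𝔼 => ‖smearedDeriv Ω η p.2 p.1‖ₑ := by
  have h : Continuous fun p : 𝔼 × 𝔼 => smearedDeriv Ω η p.2 p.1 :=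
    ((continuous_smearedDeriv hΩ.measure_lt_top.ne η).comp continuous_snd).clm_apply continuous_fst
  exact h.measurable.enorm

/-- The defining supremum is uncountable; measurability comes from the sequential limit of
`tendsto_lintegral_dirVariation`. -/
lemma measurable_dirVariation {Ω : Set 𝔼} (hΩ : Bornology.IsBounded Ω) :
    Measurable (dirVariation Ω) := by
  obtain ⟨η, hη⟩ := exists_shrinking_bumps (d := d)
  refine ENNReal.measurable_of_tendsto (f := fun n u => ∫⁻ y, ‖smearedDeriv Ω (η n) y u‖ₑ)
    (fun n => (measurable_enorm_smearedDeriv_apply hΩ (η n)).lintegral_prod_right')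
    (tendsto_pi_nhds.2 fun u => tendsto_lintegral_dirVariation hΩ hη u)

/-- The constant relating the perimeter to the average of the directional variations. -/
def momentConst (d : ℕ) : ℝ :=
  2 * Real.pi ^ (((d : ℝ) - 1) / 2) / Real.Gamma (((d : ℝ) + 1) / 2)

lemma momentConst_pos (d : ℕ) : 0 < momentConst d := by
  have h4 : 0 < Real.Gamma (((d : ℝ) + 1) / 2) := Real.Gamma_pos_of_pos (by positivity)
  unfold momentConst
  have := Real.pi_pos
  positivity

lemma lintegral_sphere_enorm_dual (hd : 0 < d) (H : 𝔼 →L[ℝ] ℝ) :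
    ∫⁻ u : Metric.sphere (0 : 𝔼) 1, ‖H u‖ₑ ∂(volume : Measure 𝔼).toSphere =
      ENNReal.ofReal (momentConst d) * ‖H‖ₑ := by
  have hint : Integrable (fun u : Metric.sphere (0 : 𝔼) 1 => |H u|)
      (volume : Measure 𝔼).toSphere := by
    refine Integrable.of_bound (C := ‖H‖)
      (by fun_prop : Continuous fun u : Metric.sphere (0 : 𝔼) 1 => |H u|).aestronglyMeasurable
      (Eventually.of_forall fun u => ?_)
    simpa using H.le_opNorm u
  have h := ofReal_integral_eq_lintegral_ofReal hint (Eventually.of_forall fun u => abs_nonneg _)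
  rw [integral_sphere_abs_dual hd, ← momentConst,
    ENNReal.ofReal_mul (momentConst_pos d).le, ofReal_norm] at h
  rw [h]
  exact lintegral_congr fun u => by rw [← ofReal_norm, Real.norm_eq_abs]

/-- The integral over the unit sphere of the directional variations is a multiple of the
perimeter. -/
lemma lintegral_sphere_dirVariation (hd : 0 < d) {Ω : Set 𝔼} (hΩ : Bornology.IsBounded Ω)
    (hper : perimeter Ω < ∞) :
    ∫⁻ u : Metric.sphere (0 : 𝔼) 1, dirVariation Ω u ∂(volume : Measure 𝔼).toSphere =
      ENNReal.ofReal (momentConst d) * perimeter Ω := by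
  obtain ⟨η, hη⟩ := exists_shrinking_bumps (d := d)
  have h1 : Tendsto (fun n => ∫⁻ u : Metric.sphere (0 : 𝔼) 1, (∫⁻ y : 𝔼, ‖smearedDeriv Ω (η n) y u‖ₑ)
      ∂(volume : Measure 𝔼).toSphere) atTop
      (𝓝 (∫⁻ u : Metric.sphere (0 : 𝔼) 1, dirVariation Ω u ∂(volume : Measure 𝔼).toSphere)) := by
    -- The constant `perimeter Ω` dominates uniformly in `n` and `u`; this is where its finiteness
    -- is used.
    refine tendsto_lintegral_of_dominated_convergence (fun _ => perimeter Ω) (fun n => ?_)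
      (fun n => Eventually.of_forall fun u => ?_) ?_ (Eventually.of_forall fun u => ?_)
    · exact (measurable_enorm_smearedDeriv_apply hΩ (η n)).lintegral_prod_right'.comp
        measurable_subtype_coe
    · exact lintegral_smearedDeriv_apply_le_perimeter hΩ (η n) (by simp)
    · rw [lintegral_const]
      exact (ENNReal.mul_lt_top hper (measure_lt_top _ _)).ne
    · exact tendsto_lintegral_dirVariation hΩ hη u
  have h2 : ∀ n, ∫⁻ u : Metric.sphere (0 : 𝔼) 1, (∫⁻ y : 𝔼, ‖smearedDeriv Ω (η n) y u‖ₑ)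
      ∂(volume : Measure 𝔼).toSphere =
      ENNReal.ofReal (momentConst d) * ∫⁻ y, ‖smearedDeriv Ω (η n) y‖ₑ := fun n => by
    rw [lintegral_lintegral_swap, ← lintegral_const_mul']
    · exact lintegral_congr fun y => lintegral_sphere_enorm_dual hd _
    · exact ENNReal.ofReal_ne_top
    · exact ((measurable_enorm_smearedDeriv_apply hΩ (η n)).comp
        (measurable_subtype_coe.prodMap measurable_id)).aemeasurable
  simp_rw [h2] at h1
  exact tendsto_nhds_unique h1
    (ENNReal.Tendsto.const_mul (tendsto_lintegral_perimeter hΩ hη) (Or.inr ENNReal.ofReal_ne_top))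

lemma integrable_sphere_dirVariation {Ω : Set 𝔼} (hΩ : Bornology.IsBounded Ω)
    (hper : perimeter Ω < ∞) :
    Integrable (fun u : Metric.sphere (0 : 𝔼) 1 => (dirVariation Ω u).toReal)
      (volume : Measure 𝔼).toSphere := by
  refine Integrable.of_bound (C := (perimeter Ω).toReal)
    ((measurable_dirVariation hΩ).comp measurable_subtype_coe).ennreal_toReal.aestronglyMeasurable
    (Eventually.of_forall fun u => ?_)
  rw [Real.norm_of_nonneg ENNReal.toReal_nonneg]
  exact ENNReal.toReal_mono hper.ne (dirVariation_le_perimeter hΩ (by simp))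

lemma integral_sphere_dirVariation (hd : 0 < d) {Ω : Set 𝔼} (hΩ : Bornology.IsBounded Ω)
    (hper : perimeter Ω < ∞) :
    ∫ u : Metric.sphere (0 : 𝔼) 1, (dirVariation Ω u).toReal ∂(volume : Measure 𝔼).toSphere =
      momentConst d * (perimeter Ω).toReal := by
  rw [integral_toReal, lintegral_sphere_dirVariation hd hΩ hper, ENNReal.toReal_mul,
    ENNReal.toReal_ofReal (momentConst_pos d).le]
  · exact ((measurable_dirVariation hΩ).comp measurable_subtype_coe).aemeasurable
  · exact Eventually.of_forall fun u =>
      (dirVariation_le_perimeter hΩ (by simp)).trans_lt hper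

end DirectionalVariation


/-! ### Mass of the Poisson kernel and the constants. -/

section PoissonMass

variable {d : ℕ}

local notation "𝔼" => EuclideanSpace ℝ (Fin d)

lemma lintegral_ofReal_exp_neg_mul_sq_norm {s : ℝ} (hs : 0 < s) :
    ∫⁻ x : 𝔼, ENNReal.ofReal (Real.exp (-s * ‖x‖ ^ 2)) =
      ENNReal.ofReal ((Real.pi / s) ^ ((d : ℝ) / 2)) := by
  have h := GaussianFourier.integral_rexp_neg_mul_sq_norm (V := 𝔼) hs
  rw [finrank_euclideanSpace, Fintype.card_fin] at h
  rw [← h, ofReal_integral_eq_lintegral_ofReal]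
  · refine .of_integral_ne_zero ?_
    rw [h]
    exact (Real.rpow_pos_of_pos (div_pos Real.pi_pos hs) _).ne'
  · exact Eventually.of_forall fun x => (Real.exp_pos _).le

lemma lintegral_ofReal_rpow_mul_exp_neg {a r : ℝ} (ha : 0 < a) (hr : 0 < r) :
    ∫⁻ s in Ioi (0 : ℝ), ENNReal.ofReal (s ^ (a - 1) * Real.exp (-(r * s))) =
      ENNReal.ofReal ((1 / r) ^ a * Real.Gamma a) := by
  have h := Real.integral_rpow_mul_exp_neg_mul_Ioi ha hr
  rw [← h, ofReal_integral_eq_lintegral_ofReal]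
  · refine .of_integral_ne_zero ?_
    rw [h]
    exact (mul_pos (Real.rpow_pos_of_pos (by positivity) _) (Real.Gamma_pos_of_pos ha)).ne'
  · filter_upwards [ae_restrict_mem measurableSet_Ioi] with s (hs : 0 < s)
    exact mul_nonneg (Real.rpow_nonneg hs.le _) (Real.exp_pos _).le

/-- Subordination: the Gamma integral writes the power as a superposition of Gaussians in `x`. After
Tonelli and the Gaussian integral, a Gamma integral with exponent `1/2` remains. -/
lemma lintegral_ofReal_one_div_rpow (t : ℝ) (ht : 0 < t) :
    ∫⁻ x : 𝔼, ENNReal.ofReal ((1 / (t ^ 2 + ‖x‖ ^ 2)) ^ (((d : ℝ) + 1) / 2) *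
        Real.Gamma (((d : ℝ) + 1) / 2)) =
      ENNReal.ofReal (Real.pi ^ (((d : ℝ) + 1) / 2) / t) := by
  have ha : 0 < ((d : ℝ) + 1) / 2 := by positivity
  calc _ = ∫⁻ x : 𝔼, ∫⁻ s in Ioi (0 : ℝ), ENNReal.ofReal
          (s ^ (((d : ℝ) + 1) / 2 - 1) * Real.exp (-((t ^ 2 + ‖x‖ ^ 2) * s))) :=
        lintegral_congr fun x => (lintegral_ofReal_rpow_mul_exp_neg ha (by positivity)).symm
    _ = ∫⁻ s in Ioi (0 : ℝ), ∫⁻ x : 𝔼, ENNReal.ofReal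
          (s ^ (((d : ℝ) + 1) / 2 - 1) * Real.exp (-((t ^ 2 + ‖x‖ ^ 2) * s))) := by
        refine lintegral_lintegral_swap (Measurable.aemeasurable ?_)
        refine Measurable.ennreal_ofReal (Measurable.mul ?_ ?_)
        · exact measurable_snd.pow_const _
        · fun_prop
    _ = ∫⁻ s in Ioi (0 : ℝ), ENNReal.ofReal (Real.pi ^ ((d : ℝ) / 2)) * ENNReal.ofReal
          (s ^ ((1 : ℝ) / 2 - 1) * Real.exp (-(t ^ 2 * s))) := by
        refine setLIntegral_congr_fun measurableSet_Ioi fun s (hs : 0 < s) => ?_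
        have h1 : ∀ x : 𝔼, ENNReal.ofReal
            (s ^ (((d : ℝ) + 1) / 2 - 1) * Real.exp (-((t ^ 2 + ‖x‖ ^ 2) * s))) =
            ENNReal.ofReal (s ^ (((d : ℝ) + 1) / 2 - 1) * Real.exp (-(t ^ 2 * s))) *
              ENNReal.ofReal (Real.exp (-s * ‖x‖ ^ 2)) := fun x => by
          rw [← ENNReal.ofReal_mul (by positivity), mul_assoc, ← Real.exp_add]
          ring_nf
        simp only [h1]
        rw [lintegral_const_mul' _ _ ENNReal.ofReal_ne_top,
          lintegral_ofReal_exp_neg_mul_sq_norm hs, ← ENNReal.ofReal_mul (by positivity),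
          ← ENNReal.ofReal_mul (by have := Real.pi_pos; positivity)]
        congr 1
        rw [Real.div_rpow Real.pi_pos.le hs.le,
          show (1 : ℝ) / 2 - 1 = (((d : ℝ) + 1) / 2 - 1) - (d : ℝ) / 2 by ring,
          Real.rpow_sub hs _ ((d : ℝ) / 2)]
        ring
    _ = _ := by
        rw [lintegral_const_mul' _ _ ENNReal.ofReal_ne_top,
          lintegral_ofReal_rpow_mul_exp_neg (by norm_num) (by positivity),
          ← ENNReal.ofReal_mul (by have := Real.pi_pos; positivity)]
        congr 1
        rw [Real.Gamma_one_half_eq, ← Real.sqrt_eq_rpow, Real.sqrt_div zero_le_one,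
          Real.sqrt_sq ht.le, add_div, Real.rpow_add Real.pi_pos, Real.sqrt_eq_rpow Real.pi,
          Real.sqrt_one]
        ring

lemma kappa_pos (d : ℕ) : 0 < kappa d := by
  have h4 : 0 < Real.Gamma (((d : ℝ) + 1) / 2) := Real.Gamma_pos_of_pos (by positivity)
  have := Real.pi_pos
  unfold kappa
  positivity

lemma poissonKernel_nonneg {t : ℝ} (ht : 0 < t) (x : 𝔼) : 0 ≤ poissonKernel t x := by
  have := kappa_pos d
  unfold poissonKernel
  positivity

lemma continuous_poissonKernel {t : ℝ} (ht : 0 < t) :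
    Continuous (poissonKernel t : 𝔼 → ℝ) := by
  unfold poissonKernel
  refine continuous_const.div (Continuous.rpow_const (by fun_prop) fun x => ?_) fun x => ?_
  · exact Or.inl (by positivity)
  · positivity

lemma lintegral_poissonKernel {t : ℝ} (ht : 0 < t) :
    ∫⁻ x : 𝔼, ENNReal.ofReal (poissonKernel t x) = 1 := by
  have hΓ : 0 < Real.Gamma (((d : ℝ) + 1) / 2) := Real.Gamma_pos_of_pos (by positivity)
  have hπ : 0 < Real.pi ^ (((d : ℝ) + 1) / 2) := Real.rpow_pos_of_pos Real.pi_pos _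
  have h1 : ∀ x : 𝔼, ENNReal.ofReal (poissonKernel t x) =
      ENNReal.ofReal (t / Real.pi ^ (((d : ℝ) + 1) / 2)) *
        ENNReal.ofReal ((1 / (t ^ 2 + ‖x‖ ^ 2)) ^ (((d : ℝ) + 1) / 2) *
        Real.Gamma (((d : ℝ) + 1) / 2)) := fun x => by
    rw [← ENNReal.ofReal_mul (by positivity)]
    congr 1
    rw [Real.div_rpow zero_le_one (by positivity), Real.one_rpow, poissonKernel, kappa]
    ring
  simp_rw [h1]
  rw [lintegral_const_mul' _ _ ENNReal.ofReal_ne_top, lintegral_ofReal_one_div_rpow t ht,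
    ← ENNReal.ofReal_mul (by positivity), ← ENNReal.ofReal_one]
  congr 1
  field_simp

lemma integrable_poissonKernel {t : ℝ} (ht : 0 < t) :
    Integrable (poissonKernel t : 𝔼 → ℝ) := by
  refine ⟨(continuous_poissonKernel ht).aestronglyMeasurable, ?_⟩
  rw [hasFiniteIntegral_iff_ofReal (Eventually.of_forall (poissonKernel_nonneg ht)),
    lintegral_poissonKernel ht]
  exact ENNReal.one_lt_top

lemma integral_poissonKernel {t : ℝ} (ht : 0 < t) : ∫ x : 𝔼, poissonKernel t x = 1 := by
  rw [integral_eq_lintegral_of_nonneg_ae (Eventually.of_forall (poissonKernel_nonneg ht))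
    (continuous_poissonKernel ht).aestronglyMeasurable, lintegral_poissonKernel ht]
  rfl

lemma toSphere_real_univ (hd : 0 < d) :
    (volume : Measure 𝔼).toSphere.real univ = sphereArea d := by
  have : Nonempty (Fin d) := ⟨⟨0, hd⟩⟩
  rw [Measure.toSphere_real_apply_univ, finrank_euclideanSpace, Fintype.card_fin,
    measureReal_def, EuclideanSpace.volume_ball, sphereArea, Fintype.card_fin]
  have hd' : (0 : ℝ) < (d : ℝ) / 2 := by positivity
  rw [Real.Gamma_add_one hd'.ne']
  have hΓ := Real.Gamma_pos_of_pos hd'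
  have hs : √Real.pi ^ d = Real.pi ^ ((d : ℝ) / 2) := by
    rw [Real.sqrt_eq_rpow, ← Real.rpow_natCast, ← Real.rpow_mul Real.pi_pos.le]
    congr 1; ring
  have := Real.pi_pos
  rw [hs, ENNReal.ofReal_one, one_pow, one_mul, ENNReal.toReal_ofReal (by positivity)]
  field_simp

lemma kappa_mul_momentConst (d : ℕ) : kappa d * (momentConst d / 2) = 1 / Real.pi := by
  have hΓ : 0 < Real.Gamma (((d : ℝ) + 1) / 2) := Real.Gamma_pos_of_pos (by positivity)
  have hπ := Real.rpow_pos_of_pos Real.pi_pos (((d : ℝ) - 1) / 2)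
  rw [kappa, momentConst, show ((d : ℝ) + 1) / 2 = ((d : ℝ) - 1) / 2 + 1 by ring,
    Real.rpow_add_one Real.pi_pos.ne', ← show ((d : ℝ) + 1) / 2 = ((d : ℝ) - 1) / 2 + 1 by ring]
  have := Real.pi_pos
  field_simp

end PoissonMass

/-! ### Asymptotics of the radial integrals as `t → 0+`. -/

section Radial

lemma rpow_half_sq {x : ℝ} (hx : 0 ≤ x) (n : ℕ) :
    (x ^ 2) ^ (((n : ℝ) + 1) / 2) = x ^ (n + 1) := by
  rw [← Real.rpow_natCast x 2, ← Real.rpow_mul hx, ← Real.rpow_natCast]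
  congr 1; push_cast; ring

/-- The radial weight `r^d / (t² + r²)^((d+1)/2)`. -/
def radialWeight (d : ℕ) (t r : ℝ) : ℝ := r ^ d / (t ^ 2 + r ^ 2) ^ (((d : ℝ) + 1) / 2)

lemma radialWeight_nonneg (d : ℕ) (t : ℝ) {r : ℝ} (hr : 0 ≤ r) : 0 ≤ radialWeight d t r := by
  unfold radialWeight; positivity

/-- Uniformity in `t` makes this the source of every domination used for the limit `t → 0+`. -/
lemma radialWeight_mul_le_one (d : ℕ) (t : ℝ) {r : ℝ} (hr : 0 < r) :
    r * radialWeight d t r ≤ 1 := by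
  unfold radialWeight
  rw [← mul_div_assoc, ← pow_succ', div_le_one (by positivity), ← rpow_half_sq hr.le]
  exact Real.rpow_le_rpow (by positivity) (by nlinarith [sq_nonneg t]) (by positivity)

lemma continuous_radialWeight (d : ℕ) {t : ℝ} (ht : 0 < t) : Continuous (radialWeight d t) := by
  unfold radialWeight
  refine (continuous_pow d).div (Continuous.rpow_const (by fun_prop) fun x => ?_) fun x => ?_
  · exact Or.inl (by positivity)
  · positivity

lemma tendsto_radialWeight (d : ℕ) {r : ℝ} (hr : 0 < r) :
    Tendsto (fun t => radialWeight d t r) (𝓝[>] 0) (𝓝 (1 / r)) := by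
  have h : ContinuousAt (fun t => radialWeight d t r) 0 := by
    unfold radialWeight
    refine continuousAt_const.div (ContinuousAt.rpow_const (by fun_prop) ?_) ?_
    · exact Or.inl (by positivity)
    · positivity
  have h0 : radialWeight d 0 r = 1 / r := by
    unfold radialWeight
    rw [zero_pow two_ne_zero, zero_add, rpow_half_sq hr.le, pow_succ]
    field_simp
  rw [← h0]
  exact h.tendsto.mono_left nhdsWithin_le_nhds

lemma one_sub_tanh_le (θ : ℝ) : 1 - Real.tanh θ ≤ 2 * Real.exp (-2 * θ) := by
  have h1 : Real.exp (-2 * θ) = Real.exp (-θ) / Real.exp θ := by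
    rw [← Real.exp_sub]; ring_nf
  have hp := Real.exp_pos θ
  have hm := Real.exp_pos (-θ)
  rw [Real.tanh_eq_sinh_div_cosh, Real.sinh_eq, Real.cosh_eq, h1, one_sub_div (by positivity),
    ← mul_div_assoc, div_le_div_iff₀ (by positivity) hp]
  nlinarith [mul_pos hm hm]

lemma integrableOn_tanh_pow_sub_one (d : ℕ) :
    IntegrableOn (fun θ : ℝ => Real.tanh θ ^ d - 1) (Ioi 0) := by
  have hi : IntegrableOn (fun θ : ℝ => (d : ℝ) * (2 * Real.exp (-2 * θ))) (Ioi 0) :=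
    ((exp_neg_integrableOn_Ioi 0 two_pos).const_mul 2).const_mul _
  have hc : Continuous Real.tanh := by
    rw [show Real.tanh = fun x => Real.sinh x / Real.cosh x from
      funext Real.tanh_eq_sinh_div_cosh]
    exact Real.continuous_sinh.div Real.continuous_cosh fun x => (Real.cosh_pos x).ne'
  refine hi.mono' (by fun_prop : Continuous fun θ : ℝ => Real.tanh θ ^ d - 1).aestronglyMeasurable
    ?_
  filter_upwards [ae_restrict_mem measurableSet_Ioi] with θ (hθ : 0 < θ)
  have h0 : 0 ≤ Real.tanh θ := by
    rw [Real.tanh_eq_sinh_div_cosh]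
    exact div_nonneg (Real.sinh_nonneg_iff.2 hθ.le) (Real.cosh_pos θ).le
  have h1 : Real.tanh θ ≤ 1 := (Real.tanh_lt_one θ).le
  -- Bernoulli's inequality: `1 - tanh^d θ ≤ d (1 - tanh θ)`, which decays exponentially.
  have hb := one_add_mul_le_pow (a := Real.tanh θ - 1) (by linarith) d
  rw [add_sub_cancel] at hb
  rw [Real.norm_eq_abs, abs_sub_comm, abs_of_nonneg (sub_nonneg.2 (pow_le_one₀ h0 h1))]
  have := mul_le_mul_of_nonneg_left (one_sub_tanh_le θ) (Nat.cast_nonneg (α := ℝ) d)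
  linarith

/-- Substituting `r = t sinh θ` makes `t² + r² = (t cosh θ)²`, and the Jacobian `t cosh θ` lowers
the denominator to the `d`-th power. -/
lemma integral_radialWeight_eq_tanh (d : ℕ) {t : ℝ} (ht : 0 < t) (l : ℝ) :
    ∫ r in (0 : ℝ)..l, radialWeight d t r =
      ∫ θ in (0 : ℝ)..Real.arsinh (l / t), Real.tanh θ ^ d := by
  have h := intervalIntegral.integral_comp_mul_deriv (a := 0) (b := Real.arsinh (l / t))
    (f := fun θ => t * Real.sinh θ) (f' := fun θ => t * Real.cosh θ) (g := radialWeight d t)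
    (fun θ _ => (Real.hasDerivAt_sinh θ).const_mul t)
    (Real.continuous_cosh.const_mul t).continuousOn (continuous_radialWeight d ht)
  simp only [Real.sinh_zero, mul_zero, Real.sinh_arsinh, mul_div_cancel₀ _ ht.ne'] at h
  rw [← h]
  refine intervalIntegral.integral_congr fun θ _ => ?_
  have hc := Real.cosh_pos θ
  have hsq : t ^ 2 + (t * Real.sinh θ) ^ 2 = (t * Real.cosh θ) ^ 2 := by
    rw [mul_pow, mul_pow, Real.cosh_sq]; ring
  simp only [Function.comp_apply, radialWeight]
  rw [hsq, rpow_half_sq (by positivity), Real.tanh_eq_sinh_div_cosh, div_pow, mul_pow, pow_succ,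
    mul_pow]
  field_simp

/-- Splitting `tanh^d = (tanh^d - 1) + 1` leaves a convergent integral plus `arsinh(l/t)`, and
`arsinh(l/t) - ln(1/t) = ln(l + √(t² + l²))` tends to `ln(2l)`. -/
lemma tendsto_integral_radialWeight_sub_log (d : ℕ) {l : ℝ} (hl : 0 < l) :
    Tendsto (fun t => (∫ r in (0 : ℝ)..l, radialWeight d t r) - Real.log (1 / t)) (𝓝[>] 0)
      (𝓝 (Real.log (2 * l) + ∫ θ in Ioi (0 : ℝ), (Real.tanh θ ^ d - 1))) := by
  have hdiv : Tendsto (fun t => l / t) (𝓝[>] 0) atTop := by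
    simpa [div_eq_mul_inv] using tendsto_inv_nhdsGT_zero.const_mul_atTop hl
  have harsinh : Tendsto (fun t => Real.arsinh (l / t)) (𝓝[>] 0) atTop :=
    Real.sinhOrderIso.symm.tendsto_atTop.comp hdiv
  have h1 := intervalIntegral_tendsto_integral_Ioi 0 (integrableOn_tanh_pow_sub_one d) harsinh
  have h2 : Tendsto (fun t : ℝ => Real.log (l + √(t ^ 2 + l ^ 2))) (𝓝[>] 0)
      (𝓝 (Real.log (2 * l))) := by
    have hc : ContinuousAt (fun t : ℝ => Real.log (l + √(t ^ 2 + l ^ 2))) 0 := by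
      refine ContinuousAt.log (by fun_prop) ?_
      positivity
    have h := hc.tendsto.mono_left (nhdsWithin_le_nhds (s := Ioi 0))
    rwa [zero_pow two_ne_zero, zero_add, Real.sqrt_sq hl.le, ← two_mul] at h
  refine (h2.add h1).congr' ?_
  filter_upwards [self_mem_nhdsWithin] with t (ht : 0 < t)
  have hlog : Real.arsinh (l / t) - Real.log (1 / t) = Real.log (l + √(t ^ 2 + l ^ 2)) := by
    rw [Real.arsinh, ← Real.log_div (by positivity) (by positivity)]
    congr 1
    have : 1 + (l / t) ^ 2 = (t ^ 2 + l ^ 2) / t ^ 2 := by field_simp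
    rw [this, Real.sqrt_div (by positivity), Real.sqrt_sq ht.le]
    field_simp
  have hi := ((intervalIntegrable_iff_integrableOn_Ioc_of_le
    (Real.arsinh_nonneg_iff.2 (by positivity : 0 ≤ l / t))).2
    ((integrableOn_tanh_pow_sub_one d).mono_set Ioc_subset_Ioi_self))
  have h3 : ∫ θ in (0 : ℝ)..Real.arsinh (l / t), Real.tanh θ ^ d =
      (∫ θ in (0 : ℝ)..Real.arsinh (l / t), (Real.tanh θ ^ d - 1)) + Real.arsinh (l / t) := by
    have := intervalIntegral.integral_add hi
      (intervalIntegrable_const (c := (1 : ℝ)) (μ := volume))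
    simpa using this
  rw [integral_radialWeight_eq_tanh d ht, h3, ← hlog]
  ring

lemma radialWeight_div_le (d : ℕ) (t : ℝ) {r : ℝ} (hr : 0 < r) :
    radialWeight d t r / r ≤ r ^ (-2 : ℝ) := by
  rw [Real.rpow_neg hr.le, Real.rpow_two, div_le_iff₀ hr, inv_mul_eq_div,
    le_div_iff₀ (by positivity)]
  nlinarith [radialWeight_mul_le_one d t hr]

lemma integrableOn_radialWeight_div (d : ℕ) {t l : ℝ} (ht : 0 < t) (hl : 0 < l) :
    IntegrableOn (fun r => radialWeight d t r / r) (Ioi l) := by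
  refine (integrableOn_Ioi_rpow_of_lt (by norm_num : (-2 : ℝ) < -1) hl).mono' ?_ ?_
  · exact ((continuous_radialWeight d ht).measurable.div measurable_id).aestronglyMeasurable
  · filter_upwards [ae_restrict_mem measurableSet_Ioi] with r (hr : l < r)
    have hr0 := hl.trans hr
    rw [Real.norm_of_nonneg (div_nonneg (radialWeight_nonneg d t hr0.le) hr0.le)]
    exact radialWeight_div_le d t hr0

lemma tendsto_integral_radialWeight_div (d : ℕ) {l : ℝ} (hl : 0 < l) :
    Tendsto (fun t => ∫ r in Ioi l, radialWeight d t r / r) (𝓝[>] 0) (𝓝 (1 / l)) := by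
  have hlim : ∫ r in Ioi l, r ^ (-2 : ℝ) = 1 / l := by
    rw [integral_Ioi_rpow_of_lt (by norm_num) hl]
    norm_num [Real.rpow_neg_one]
  rw [← hlim]
  refine tendsto_integral_filter_of_dominated_convergence (fun r => r ^ (-2 : ℝ)) ?_ ?_
    (integrableOn_Ioi_rpow_of_lt (by norm_num : (-2 : ℝ) < -1) hl) ?_
  · filter_upwards [self_mem_nhdsWithin] with t (ht : 0 < t)
    exact (integrableOn_radialWeight_div d ht hl).aestronglyMeasurable
  · refine Eventually.of_forall fun t => ?_
    filter_upwards [ae_restrict_mem measurableSet_Ioi] with r (hr : l < r)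
    have hr0 := hl.trans hr
    rw [Real.norm_of_nonneg (div_nonneg (radialWeight_nonneg d t hr0.le) hr0.le)]
    exact radialWeight_div_le d t hr0
  · filter_upwards [ae_restrict_mem measurableSet_Ioi] with r (hr : l < r)
    have hr0 := hl.trans hr
    have h := (tendsto_radialWeight d hr0).div_const r
    rwa [show 1 / r / r = r ^ (-2 : ℝ) by
      rw [Real.rpow_neg hr0.le, Real.rpow_two, div_div, one_div, sq]] at h

lemma tendsto_integral_radialWeight_mul (d : ℕ) {l : ℝ} (hl : 0 < l) {γ : ℝ → ℝ}
    (hγ : IntegrableOn (fun s => s⁻¹ * γ s) (Ioo 0 1)) :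
    Tendsto (fun t => ∫ s in Ioo (0 : ℝ) 1, (l * s * radialWeight d t (l * s)) * (s⁻¹ * γ s))
      (𝓝[>] 0) (𝓝 (∫ s in Ioo (0 : ℝ) 1, s⁻¹ * γ s)) := by
  refine tendsto_integral_filter_of_dominated_convergence (fun s => ‖s⁻¹ * γ s‖) ?_ ?_ hγ.norm ?_
  · filter_upwards [self_mem_nhdsWithin] with t (ht : 0 < t)
    have hc := continuous_radialWeight d ht
    exact (by fun_prop : Continuous fun s => l * s * radialWeight d t (l * s)).aestronglyMeasurable.mul
      hγ.aestronglyMeasurable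
  · refine Eventually.of_forall fun t => ?_
    filter_upwards [ae_restrict_mem measurableSet_Ioo] with s hs
    have hls : 0 < l * s := mul_pos hl hs.1
    rw [norm_mul, Real.norm_of_nonneg (mul_nonneg hls.le (radialWeight_nonneg d t hls.le))]
    exact mul_le_of_le_one_left (norm_nonneg _) (radialWeight_mul_le_one d t hls)
  · filter_upwards [ae_restrict_mem measurableSet_Ioo] with s hs
    have hls : 0 < l * s := mul_pos hl hs.1
    have h := ((tendsto_radialWeight d hls).const_mul (l * s)).mul_const (s⁻¹ * γ s)
    rwa [mul_one_div_cancel hls.ne', one_mul] at h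

end Radial


/-! ### The covariance function and the exact radial formula. -/

section Covariance

variable {d : ℕ}

local notation "𝔼" => EuclideanSpace ℝ (Fin d)

lemma image_add_right_eq (Ω : Set 𝔼) (y : 𝔼) :
    (fun x => x + y) '' Ω = (fun x => x - y) ⁻¹' Ω := by
  rw [Set.image_add_right]
  simp [sub_eq_add_neg]

lemma covariance_eq (Ω : Set 𝔼) (y : 𝔼) :
    covariance Ω y = volume.real (Ω ∩ (fun x => x - y) ⁻¹' Ω) := by
  rw [covariance, image_add_right_eq]

lemma covariance_zero (Ω : Set 𝔼) : covariance Ω 0 = volume.real Ω := by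
  simp [covariance_eq]

lemma covariance_nonneg (Ω : Set 𝔼) (y : 𝔼) : 0 ≤ covariance Ω y := measureReal_nonneg

lemma covariance_le {Ω : Set 𝔼} (hΩ : Bornology.IsBounded Ω) (y : 𝔼) :
    covariance Ω y ≤ covariance Ω 0 := by
  rw [covariance_zero]
  exact measureReal_mono inter_subset_left hΩ.measure_lt_top.ne

lemma covariance_congr {Ω Ω' : Set 𝔼} (h : Ω =ᵐ[volume] Ω') : covariance Ω = covariance Ω' := by
  ext y
  rw [covariance_eq, covariance_eq]
  refine measureReal_congr (h.inter ?_)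
  exact (measurePreserving_sub_right volume y).quasiMeasurePreserving.preimage_ae_eq h

lemma heatContent_congr {Ω Ω' : Set 𝔼} (h : Ω =ᵐ[volume] Ω') :
    heatContent Ω = heatContent Ω' := by
  ext t
  simp only [heatContent, Measure.restrict_congr_set h]

lemma measurableSet_overlap {Ω : Set 𝔼} (hΩ : MeasurableSet Ω) :
    MeasurableSet {p : 𝔼 × 𝔼 | p.2 ∈ Ω ∧ p.2 - p.1 ∈ Ω} :=
  (measurable_snd hΩ).inter ((measurable_snd.sub measurable_fst) hΩ)

lemma measurable_covariance {Ω : Set 𝔼} (hΩ : NullMeasurableSet Ω) :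
    Measurable (covariance Ω) := by
  rw [covariance_congr hΩ.toMeasurable_ae_eq.symm]
  have := measurable_measure_prodMk_left (ν := (volume : Measure 𝔼))
    (measurableSet_overlap (measurableSet_toMeasurable volume Ω))
  convert this.ennreal_toReal using 1
  ext y
  rw [covariance_eq]
  rfl

/-- If `g` vanished off the origin, Fubini would make the overlap set `{(y, x) : x ∈ Ω, x - y ∈ Ω}`
null. But its slice at each `x ∈ Ω` is `x - Ω`, of measure `|Ω| > 0`. -/
lemma exists_covariance_ne_zero {Ω : Set 𝔼} (hΩ : NullMeasurableSet Ω)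
    (hb : Bornology.IsBounded Ω) (hpos : 0 < volume Ω) [Nontrivial 𝔼] :
    ∃ y, y ≠ 0 ∧ covariance Ω y ≠ 0 := by
  -- A Borel representative gives a measurable overlap set; the covariance depends only on the a.e.
  -- class.
  set Ω' := toMeasurable volume Ω with hΩ'
  have hae : Ω' =ᵐ[volume] Ω := hΩ.toMeasurable_ae_eq
  have hm : MeasurableSet Ω' := measurableSet_toMeasurable volume Ω
  have hpos' : 0 < volume Ω' := by rwa [measure_congr hae]
  have hfin : volume Ω' ≠ ∞ := by rw [measure_congr hae]; exact hb.measure_lt_top.ne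
  by_contra! h
  rw [← covariance_congr hae] at h
  have h1 : (volume.prod volume) {p : 𝔼 × 𝔼 | p.2 ∈ Ω' ∧ p.2 - p.1 ∈ Ω'} = 0 := by
    rw [Measure.measure_prod_null (measurableSet_overlap hm)]
    filter_upwards [compl_mem_ae_iff.2 (measure_singleton (0 : 𝔼))] with y hy
    have hy' := h y hy
    rw [covariance_eq, measureReal_eq_zero_iff
      (measure_ne_top_of_subset inter_subset_left hfin)] at hy'
    exact hy'
  rw [← Measure.prod_swap, Measure.map_apply measurable_swap (measurableSet_overlap hm),
    Measure.measure_prod_null (measurable_swap (measurableSet_overlap hm))] at h1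
  have h2 : ∀ᵐ x : 𝔼, x ∉ Ω' := by
    filter_upwards [h1] with x hx hxΩ
    have h3 : Prod.mk x ⁻¹' (Prod.swap ⁻¹' {p : 𝔼 × 𝔼 | p.2 ∈ Ω' ∧ p.2 - p.1 ∈ Ω'}) =
        (fun z => x - z) ⁻¹' Ω' := by
      ext z; simp [hxΩ]
    rw [h3, (Measure.measurePreserving_sub_left volume x).measure_preimage hm.nullMeasurableSet] at hx
    exact hpos'.ne' hx
  exact hpos'.ne' (measure_eq_zero_iff_ae_notMem.2 h2)

lemma ell_set_nonempty {Ω : Set 𝔼} (hb : Bornology.IsBounded Ω) :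
    {l : ℝ | 0 < l ∧ ∀ y : 𝔼, l ≤ ‖y‖ → covariance Ω y = 0}.Nonempty := by
  obtain ⟨R, hR⟩ := hb.subset_closedBall 0
  refine ⟨2 * |R| + 1, by positivity, fun y hy => ?_⟩
  have : Ω ∩ (fun x => x - y) ⁻¹' Ω = ∅ := by
    refine eq_empty_of_forall_notMem fun x ⟨h1, h2⟩ => ?_
    have h1 := hR h1
    have h2 := hR h2
    simp only [mem_closedBall_zero_iff] at h1 h2
    have h3 := norm_sub_le x (x - y)
    rw [sub_sub_cancel] at h3
    linarith [le_abs_self R]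
  rw [covariance_eq, this, measureReal_empty]

/-- The strict inequality avoids asking whether the infimum is attained; the radius `ell Ω` itself
is negligible. -/
lemma covariance_eq_zero {Ω : Set 𝔼} (hb : Bornology.IsBounded Ω) {y : 𝔼} (hy : ell Ω < ‖y‖) :
    covariance Ω y = 0 := by
  obtain ⟨l, ⟨_, hl⟩, hly⟩ := exists_lt_of_csInf_lt (ell_set_nonempty hb) hy
  exact hl y hly.le

lemma ell_pos {Ω : Set 𝔼} (hΩ : NullMeasurableSet Ω) (hb : Bornology.IsBounded Ω)
    (hpos : 0 < volume Ω) [Nontrivial 𝔼] : 0 < ell Ω := by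
  obtain ⟨y, hy, hcov⟩ := exists_covariance_ne_zero hΩ hb hpos
  by_contra! h
  exact hcov (covariance_eq_zero hb (h.trans_lt (norm_pos_iff.2 hy)))

lemma heatContent_eq_integral_covariance {Ω : Set 𝔼} (hΩ : NullMeasurableSet Ω)
    (hb : Bornology.IsBounded Ω) {t : ℝ} (ht : 0 < t) :
    heatContent Ω t = ∫ z : 𝔼, poissonKernel t z * covariance Ω z := by
  set Ω' := toMeasurable volume Ω with hΩ'
  have hae : Ω' =ᵐ[volume] Ω := hΩ.toMeasurable_ae_eq
  have hm : MeasurableSet Ω' := measurableSet_toMeasurable volume Ω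
  have hfin : volume Ω' ≠ ∞ := by rw [measure_congr hae]; exact hb.measure_lt_top.ne
  have : IsFiniteMeasure (volume.restrict Ω') := ⟨by simpa using hfin.lt_top⟩
  rw [← covariance_congr hae, ← heatContent_congr hae, heatContent]
  have h1 : ∀ x : 𝔼, ∫ y in Ω', poissonKernel t (x - y) =
      ∫ z, Ω'.indicator 1 (x - z) * poissonKernel t z := fun x => by
    rw [← integral_indicator hm, ← integral_sub_left_eq_self _ _ x]
    refine integral_congr_ae (Eventually.of_forall fun z => ?_)
    by_cases hz : x - z ∈ Ω' <;> simp [hz]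
  have h2 : ∀ z : 𝔼, poissonKernel t z * covariance Ω' z =
      ∫ x in Ω', Ω'.indicator 1 (x - z) * poissonKernel t z := fun z => by
    rw [integral_mul_const, mul_comm, covariance_eq]
    congr 1
    have h3 : (fun x => Ω'.indicator (1 : 𝔼 → ℝ) (x - z)) =
        ((fun x => x - z) ⁻¹' Ω').indicator 1 := rfl
    have hm' : MeasurableSet ((fun x => x - z) ⁻¹' Ω') := (measurable_sub_const z) hm
    rw [h3, integral_indicator_one hm', measureReal_restrict_apply hm', inter_comm]
  simp_rw [h1, h2]
  refine integral_integral_swap ?_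
  have h4 : Integrable (fun p : 𝔼 × 𝔼 => poissonKernel t p.2)
      ((volume.restrict Ω').prod volume) := (integrable_poissonKernel ht).comp_snd _
  have h5 : Measurable fun p : 𝔼 × 𝔼 => Ω'.indicator (1 : 𝔼 → ℝ) (p.1 - p.2) :=
    (measurable_one.indicator hm).comp (measurable_fst.sub measurable_snd)
  refine h4.bdd_mul (c := 1) h5.aestronglyMeasurable (Eventually.of_forall fun p => ?_)
  by_cases hp : p.1 - p.2 ∈ Ω' <;> simp [hp]

/-- The spherical integral of the covariance deficit in terms of `gam`. -/
lemma integral_sphere_covariance_deficit (hd : 0 < d) {Ω : Set 𝔼} (hΩ : NullMeasurableSet Ω)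
    (hb : Bornology.IsBounded Ω) (hper : perimeter Ω < ∞) {r : ℝ} (hr : 0 < r) :
    ∫ u : Metric.sphere (0 : 𝔼) 1, (covariance Ω 0 - covariance Ω (r • (u : 𝔼)))
        ∂(volume : Measure 𝔼).toSphere =
      r * (momentConst d / 2 * (perimeter Ω).toReal - gam Ω r) := by
  have hint : Integrable (fun u : Metric.sphere (0 : 𝔼) 1 =>
      covariance Ω 0 - covariance Ω (r • (u : 𝔼))) (volume : Measure 𝔼).toSphere := by
    refine Integrable.of_bound (C := covariance Ω 0) ?_ (Eventually.of_forall fun u => ?_)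
    · exact (((measurable_covariance hΩ).comp
        (measurable_subtype_coe.const_smul r)).const_sub _).aestronglyMeasurable
    · rw [Real.norm_of_nonneg (sub_nonneg.2 (covariance_le hb _))]
      linarith [covariance_nonneg Ω (r • (u : 𝔼))]
  rw [gam, integral_sub ((integrable_sphere_dirVariation hb hper).div_const 2) (hint.div_const r),
    integral_div, integral_div, integral_sphere_dirVariation hd hb hper]
  field_simp
  ring

lemma volume_sub_heatContent {Ω : Set 𝔼} (hΩ : NullMeasurableSet Ω)
    (hb : Bornology.IsBounded Ω) {t : ℝ} (ht : 0 < t) :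
    Integrable (fun z : 𝔼 => poissonKernel t z * (covariance Ω 0 - covariance Ω z)) ∧
      volume.real Ω - heatContent Ω t =
        ∫ z : 𝔼, poissonKernel t z * (covariance Ω 0 - covariance Ω z) := by
  have hp := integrable_poissonKernel (d := d) ht
  have h1 : Integrable fun z : 𝔼 => poissonKernel t z * covariance Ω z := by
    refine hp.mul_bdd (c := covariance Ω 0) (measurable_covariance hΩ).aestronglyMeasurable
      (Eventually.of_forall fun z => ?_)
    rw [Real.norm_of_nonneg (covariance_nonneg Ω z)]
    exact covariance_le hb z
  simp_rw [mul_sub]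
  refine ⟨(hp.mul_const _).sub h1, ?_⟩
  rw [integral_sub (hp.mul_const _) h1, integral_mul_const, integral_poissonKernel ht, one_mul,
    covariance_zero, heatContent_eq_integral_covariance hΩ hb ht]

/-- Rescaling by `r = l s` transfers the integrability in the definition of `classW`; the factor `l
s · w_t(l s)`, bounded by one, pairs with `s⁻¹ γ(l s)`. -/
lemma integrableOn_radialWeight_mul {γ : ℝ → ℝ} {t l : ℝ} (ht : 0 < t) (hl : 0 < l)
    (hγ : IntegrableOn (fun s => s⁻¹ * γ (l * s)) (Ioo 0 1)) :
    IntegrableOn (fun r => radialWeight d t r * γ r) (Ioc 0 l) ∧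
      ∫ r in Ioc 0 l, radialWeight d t r * γ r =
        ∫ s in Ioo (0 : ℝ) 1, (l * s * radialWeight d t (l * s)) * (s⁻¹ * γ (l * s)) := by
  have heq : ∀ s ∈ Ioo (0 : ℝ) 1, (l * s * radialWeight d t (l * s)) * (s⁻¹ * γ (l * s)) =
      l * (radialWeight d t (l * s) * γ (l * s)) := fun s hs => by
    have := hs.1.ne'
    field_simp
  have hc := continuous_radialWeight d ht
  have h1 : IntegrableOn
      (fun s => (l * s * radialWeight d t (l * s)) * (s⁻¹ * γ (l * s))) (Ioo 0 1) := by
    refine Integrable.bdd_mul (c := 1) hγ (by fun_prop :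
      Continuous fun s => l * s * radialWeight d t (l * s)).aestronglyMeasurable ?_
    filter_upwards [ae_restrict_mem measurableSet_Ioo] with s hs
    have hls : 0 < l * s := mul_pos hl hs.1
    rw [Real.norm_of_nonneg (mul_nonneg hls.le (radialWeight_nonneg d t hls.le))]
    exact radialWeight_mul_le_one d t hls
  have h2 := h1.congr_fun heq measurableSet_Ioo
  have h3 : IntegrableOn (fun s => radialWeight d t (l * s) * γ (l * s)) (Ioo 0 1) := by
    refine IntegrableOn.congr_fun (h2.const_mul l⁻¹) (fun s _ => ?_) measurableSet_Ioo
    field_simp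
  rw [setIntegral_congr_fun measurableSet_Ioo heq, integral_const_mul, ← integral_Ioc_eq_integral_Ioo,
    ← intervalIntegral.integral_of_le hl.le, ← intervalIntegral.integral_of_le zero_le_one,
    intervalIntegral.integral_comp_mul_left (fun r => radialWeight d t r * γ r) hl.ne']
  refine ⟨?_, by simp [hl.ne']⟩
  rw [← intervalIntegrable_iff_integrableOn_Ioo_of_le zero_le_one] at h3
  have h4 := (IntervalIntegrable.comp_mul_left_iff (f := fun r => radialWeight d t r * γ r)
    (a := 0) (b := l) hl.ne' enorm_ne_top).1 (by simpa [hl.ne'] using h3)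
  exact (intervalIntegrable_iff_integrableOn_Ioc_of_le hl.le).1 h4

/-- The heat content deficit in radial form. -/
lemma heatContent_deficit_eq (hd : 0 < d) {Ω : Set 𝔼} (hΩ : Ω ∈ classW d) {t : ℝ} (ht : 0 < t) :
    volume.real Ω - heatContent Ω t = kappa d * t *
      (volume.real Ω * sphereArea d * (∫ r in Ioi (ell Ω), radialWeight d t r / r) +
        momentConst d / 2 * (perimeter Ω).toReal * (∫ r in (0 : ℝ)..ell Ω, radialWeight d t r) -
        ∫ s in Ioo (0 : ℝ) 1, (ell Ω * s * radialWeight d t (ell Ω * s)) *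
          (s⁻¹ * gam Ω (ell Ω * s))) := by
  obtain ⟨hm, hb, hpos, hper, hγ⟩ := hΩ
  have : NeZero d := ⟨hd.ne'⟩
  have hl := ell_pos hm hb hpos
  set l := ell Ω with hldef
  obtain ⟨hint, heq⟩ := volume_sub_heatContent hm hb ht
  obtain ⟨hwγ, hwγ'⟩ := integrableOn_radialWeight_mul (d := d) (γ := gam Ω) ht hl hγ
  have hw : IntegrableOn (radialWeight d t) (Ioc 0 l) :=
    ((continuous_radialWeight d ht).integrableOn_Icc).mono_set Ioc_subset_Icc_self
  set B := momentConst d / 2 * (perimeter Ω).toReal with hB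
  set h : ℝ → ℝ := fun r => ∫ u : Metric.sphere (0 : 𝔼) 1,
    (covariance Ω 0 - covariance Ω (r • (u : 𝔼))) ∂(volume : Measure 𝔼).toSphere with hh
  have hrad : ∀ r ∈ Ioi (0 : ℝ), r ^ (Module.finrank ℝ 𝔼 - 1) *
      ∫ u : Metric.sphere (0 : 𝔼) 1, poissonKernel t (r • (u : 𝔼)) *
        (covariance Ω 0 - covariance Ω (r • (u : 𝔼))) ∂(volume : Measure 𝔼).toSphere =
      kappa d * t * (radialWeight d t r / r * h r) := fun r (hr : 0 < r) => by
    have h1 : ∀ u : Metric.sphere (0 : 𝔼) 1, poissonKernel t (r • (u : 𝔼)) =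
        kappa d * t / (t ^ 2 + r ^ 2) ^ (((d : ℝ) + 1) / 2) := fun u => by
      rw [poissonKernel, norm_smul, norm_eq_of_mem_sphere, mul_one, Real.norm_of_nonneg hr.le]
    simp only [h1, integral_const_mul, finrank_euclideanSpace, Fintype.card_fin]
    rw [radialWeight, show r ^ d = r ^ (d - 1) * r by rw [← pow_succ, Nat.sub_add_cancel hd]]
    simp only [hh]
    field_simp
  -- The factor `r` in the spherical deficit cancels the singular `1/r`.
  have hin : ∀ r ∈ Ioc 0 l, radialWeight d t r / r * h r =
      B * radialWeight d t r - radialWeight d t r * gam Ω r := fun r hr => by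
    have hr0 := hr.1.ne'
    rw [hh]
    simp only
    rw [integral_sphere_covariance_deficit hd hm hb hper hr.1, ← hB]
    field_simp
  have hout : ∀ r ∈ Ioi l, radialWeight d t r / r * h r =
      volume.real Ω * sphereArea d * (radialWeight d t r / r) := fun r (hr : l < r) => by
    have h1 : ∀ u : Metric.sphere (0 : 𝔼) 1,
        covariance Ω 0 - covariance Ω (r • (u : 𝔼)) = volume.real Ω := fun u => by
      rw [covariance_eq_zero hb (y := r • (u : 𝔼)), sub_zero, covariance_zero]
      rwa [norm_smul, norm_eq_of_mem_sphere, mul_one, Real.norm_of_nonneg (hl.trans hr).le]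
    simp only [hh, h1, integral_const, smul_eq_mul, toSphere_real_univ hd]
    ring
  have i1 : IntegrableOn (fun r => radialWeight d t r / r * h r) (Ioc 0 l) :=
    IntegrableOn.congr_fun ((hw.const_mul B).sub hwγ) (fun r hr => (hin r hr).symm)
      measurableSet_Ioc
  have i2 : IntegrableOn (fun r => radialWeight d t r / r * h r) (Ioi l) :=
    IntegrableOn.congr_fun ((integrableOn_radialWeight_div d ht hl).const_mul _)
      (fun r hr => (hout r hr).symm) measurableSet_Ioi
  rw [heq, integral_polar volume hint, setIntegral_congr_fun measurableSet_Ioi hrad,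
    integral_const_mul, ← Ioc_union_Ioi_eq_Ioi hl.le,
    setIntegral_union (Ioc_disjoint_Ioi le_rfl) measurableSet_Ioi i1 i2,
    setIntegral_congr_fun measurableSet_Ioc hin, setIntegral_congr_fun measurableSet_Ioi hout,
    integral_const_mul, integral_sub (hw.const_mul B) hwγ, integral_const_mul, hwγ',
    intervalIntegral.integral_of_le hl.le]
  ring

end Covariance

end PoissonHeat

end

theorem theorem1 (d : ℕ) (hd : 2 ≤ d) (Ω : Set (EuclideanSpace ℝ (Fin d)))
    (hΩ : Ω ∈ PoissonHeat.classW d) :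
    IntegrableOn (fun θ : ℝ => Real.tanh θ ^ d - 1) (Ioi 0) ∧
    Tendsto
      (fun t : ℝ => (1 / t) * (volume.real Ω - PoissonHeat.heatContent Ω t
        - (PoissonHeat.perimeter Ω).toReal / Real.pi * t * Real.log (1 / t)))
      (𝓝[>] 0)
      (𝓝 (PoissonHeat.kappa d *
            (volume.real Ω * PoissonHeat.sphereArea d / PoissonHeat.ell Ω
              - ∫ s in Ioo (0 : ℝ) 1, s⁻¹ * PoissonHeat.gam Ω (PoissonHeat.ell Ω * s))
          + (PoissonHeat.perimeter Ω).toReal / Real.pi *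
            (Real.log (2 * PoissonHeat.ell Ω)
              + ∫ θ in Ioi (0 : ℝ), (Real.tanh θ ^ d - 1)))) := by
  refine ⟨PoissonHeat.integrableOn_tanh_pow_sub_one d, ?_⟩
  have hd0 : 0 < d := by omega
  have : NeZero d := ⟨hd0.ne'⟩
  have hl := PoissonHeat.ell_pos hΩ.1 hΩ.2.1 hΩ.2.2.1
  have h1 := (PoissonHeat.tendsto_integral_radialWeight_div d hl).const_mul
    (volume.real Ω * PoissonHeat.sphereArea d)
  have h2 := PoissonHeat.tendsto_integral_radialWeight_mul d hl hΩ.2.2.2.2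
  have h3 := (PoissonHeat.tendsto_integral_radialWeight_sub_log d hl).const_mul
    ((PoissonHeat.perimeter Ω).toReal / Real.pi)
  rw [mul_one_div] at h1
  refine (((h1.sub h2).const_mul (PoissonHeat.kappa d)).add h3).congr' ?_
  filter_upwards [self_mem_nhdsWithin] with t (ht : 0 < t)
  -- For `t > 0` the formula is exact, so only constants remain to be matched: `κ_d M / 2 = 1/π`
  -- makes the subtracted logarithm the one in the perimeter term.
  rw [PoissonHeat.heatContent_deficit_eq hd0 hΩ ht]
  have hk := PoissonHeat.kappa_mul_momentConst d
  have hk' : (PoissonHeat.perimeter Ω).toReal / Real.pi =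
      PoissonHeat.kappa d * (PoissonHeat.momentConst d / 2) *
        (PoissonHeat.perimeter Ω).toReal := by rw [hk]; ring
  rw [hk']
  field_simp
  ring
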